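/- Let $\nu>0$. The eight-mode model on the symmetric torus ($\delta=1$) is the system for $(\omega_1,\omega_3,\omega_5,\omega_7)\in\mathbb C^4$ (the remaining four modes being complex conjugates of these) $$\begin{aligned} \dot\omega_1&=-\nu\omega_1+\tfrac12(\omega_3\omega_7-\bar\omega_3\omega_5)+\tfrac{3}{40\nu}\omega_1(|\omega_5|^2+|\omega_7|^2),\\ \dot\omega_3&=-\nu\omega_3+\tfrac12(\bar\omega_1\omega_5-\omega_1\bar\omega_7)+\tfrac{3}{40\nu}\omega_3(|\omega_5|^2+|\omega_7|^2),\\ \dot\omega_5&=-2\nu\omega_5-\tfrac1{5\nu}\omega_5(|\omega_1|^2+|\omega_3|^2),\qquad \dot\omega_7=-2\nu\omega_7-\tfrac1{5\nu}\omega_7(|\omega_1|^2+|\omega_3|^2). \end{aligned}$$ Put $R=\frac{|\omega_1|^2}{|\omega_3|^2}$, $A=|\omega_1|^2+|\omega_3|^2$, $w=|\omega_5|^2$, $z=|\omega_7|^2$, $P=\frac{\omega_1\bar\omega_3\bar\omega_7}{|\omega_3|^2}$, $Q=\frac{\bar\omega_1\bar\omega_3\omega_5}{|\omega_3|^2}$.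 Consider the following system in the eight-dimensional real phase space of all $(R,A,w,z,P,Q)\in\mathbb R^4\times\mathbb C^2$ with $R>0$: $$\begin{aligned} \dot R&=(1+R)(\Re P-\Re Q),\qquad \dot A=-2\nu A+\tfrac{3}{20\nu}A(w+z),\\ \dot w&=-4\nu w-\tfrac{2}{5\nu}wA,\qquad \dot z=-4\nu z-\tfrac{2}{5\nu}zA,\\ \dot P&=-2\nu P+\tfrac z2(1-R)-\tfrac1{5\nu}PA+P(\Re P-\Re Q)+\tfrac P2\big(\bar Q-\tfrac QR\big),\\ \dot Q&=-2\nu Q+\tfrac w2(R-1)-\tfrac1{5\nu}QA+Q(\Re P-\Re Q)+\tfrac Q2\big(\tfrac PR-\bar P\big). \end{aligned}\tag{$*$}$$ For $r>0$ let $\vec r$ be its fixed point $R=r$, $A=w=z=0$, $P=Q=0$. Solutions below are solutions on $[0,\infty)$. (a) Every solution of the eight-mode model with $\omega_1(t)\ne0$ and $\omega_3(t)\neq 0$ for all $t\ge0$ is carried by the change of variables to a solution of $(*)$. (b) For every $r>0$ there are an open neighbourhood $V$ of $0$ in the space of $(A,w,z,P,Q)$, a smooth function $f(\cdot\,;r):V\to\mathbb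 R$ with $f(0;r)=r$, an open neighbourhood $U$ of $\vec r$ in the phase space, and constants $C,\kappa>0$, such that the codimension-one manifold $\mathcal M_r=\{R=f(A,w,z,P,Q;r),\ (A,w,z,P,Q)\in V\}$ is a local stable manifold of $\vec r$: * from every $x\in\mathcal M_r$ there is a solution of $(*)$, and every solution $X$ of $(*)$ with $X(0)=x$ stays in $\mathcal M_r$ and satisfies $\|X(t)-\vec r\|\le C\|x-\vec r\|e^{-\kappa t}$ for all $t\ge0$; * a point $x\in U$ lies in $\mathcal M_r$ if and only if some solution of $(*)$ starting at $x$ converges to $\vec r$ as $t\to\infty$; * from every $x\in U$ there is a solution of $(*)$, and for every solution $X$ of $(*)$ with $X(0)=x\in U$ there is an $r'>0$ with $\|X(t)-\vec{r'}\|\le Ce^{-\kappa t}$ for all $t\ge0$. Moreover, writing $P=P_{re}+iP_{im}$ and $Q=Q_{re}+iQ_{im}$, up to an error $O(\|(A,w,z,P,Q)\|^3)$ at $0$, $$\begin{aligned} f={}&r+\tfrac{r^2-1}{16\nu^2}w+\tfrac{r^2-1}{16\nu^2}z-\tfrac{r+1}{2\nu}P_{re}+\tfrac{r+1}{2\nu}Q_{re}-\tfrac{r^2-1}{160\nu^4}Aw-\tfrac{r^2-1}{160\nu^4}Az+\tfrac{r+1}{40\nu^3}AP_{re}-\tfrac{r+1}{40\nu^3}AQ_{re}\\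 &+\tfrac{r^2-1}{768\nu^4r}(7r^2+2r+1)wz-\tfrac{r+1}{96\nu^3r}(4r^2-r+1)wP_{re}+\tfrac{r+1}{96\nu^3}(3r+1)wQ_{re}+\tfrac{r^2-1}{768\nu^4}(3r+2)w^2\\ &-\tfrac{r+1}{96\nu^3}(3r+1)zP_{re}+\tfrac{r+1}{96\nu^3r}(4r^2-r+1)zQ_{re}+\tfrac{r^2-1}{768\nu^4}(3r+2)z^2-\tfrac{r^2-1}{8\nu^2r}P_{re}Q_{re}-\tfrac{(r+1)^2}{8\nu^2r}P_{im}Q_{im}. \end{aligned}$$ (c) Generic data select a dipole: for Lebesgue-almost every initial condition in $\mathbb C^4$ there are a solution of the eight-mode model and numbers $r\in(0,\infty)$, $C,\kappa>0$ such that, for all sufficiently large $t$, its image under the change of variables is within $Ce^{-\kappa t}$ of $\vec r$. -/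

import Mathlib

open Set Filter Topology Asymptotics MeasureTheory
open scoped ComplexConjugate ContDiff

namespace EightMode

noncomputable section

/-- The modes `(ω₁, ω₃, ω₅, ω₇)` of the eight-mode model. The other four modes are determined by
reality of the vorticity: `ω₂ = conj ω₁`, `ω₄ = conj ω₃`, `ω₈ = conj ω₅`, `ω₆ = conj ω₇`, so this
is a real eight-dimensional phase space. -/
abbrev Modes : Type := ℂ × ℂ × ℂ × ℂ

/-- The right-hand side of the eight-mode model on the symmetric torus (`δ = 1`), with
viscosity `ν`. -/
def modeField (ν : ℝ) : Modes → Modes := fun (ω₁, ω₃, ω₅, ω₇) =>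
  (-ν * ω₁ + 1 / 2 * (ω₃ * ω₇ - conj ω₃ * ω₅)
      + 3 / (40 * ν) * ω₁ * (‖ω₅‖ ^ 2 + ‖ω₇‖ ^ 2 : ℝ),
    -ν * ω₃ + 1 / 2 * (conj ω₁ * ω₅ - ω₁ * conj ω₇)
      + 3 / (40 * ν) * ω₃ * (‖ω₅‖ ^ 2 + ‖ω₇‖ ^ 2 : ℝ),
    -2 * ν * ω₅ - 1 / (5 * ν) * ω₅ * (‖ω₁‖ ^ 2 + ‖ω₃‖ ^ 2 : ℝ),
    -2 * ν * ω₇ - 1 / (5 * ν) * ω₇ * (‖ω₁‖ ^ 2 + ‖ω₃‖ ^ 2 : ℝ))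

/-- `u` is a solution of the eight-mode model on `[0, ∞)`. -/
def IsModeSolution (ν : ℝ) (u : ℝ → Modes) : Prop :=
  ∀ t, 0 ≤ t → HasDerivWithinAt u (modeField ν (u t)) (Ici 0) t

/-- The variables `(A, w, z, P, Q)`; a real vector space of dimension seven. -/
abbrev Transverse : Type := ℝ × ℝ × ℝ × ℂ × ℂ

/-- The variables `(R, A, w, z, P, Q)`; a real vector space of dimension eight. -/
abbrev State : Type := ℝ × Transverse

/-- The change of variables from the modes to `(R, A, w, z, P, Q)`, meaningful for `ω₃ ≠ 0`. -/
def changeVars : Modes → State := fun (ω₁, ω₃, ω₅, ω₇) =>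
  (‖ω₁‖ ^ 2 / ‖ω₃‖ ^ 2,
    ‖ω₁‖ ^ 2 + ‖ω₃‖ ^ 2,
    ‖ω₅‖ ^ 2,
    ‖ω₇‖ ^ 2,
    ω₁ * conj ω₃ * conj ω₇ / (‖ω₃‖ ^ 2 : ℝ),
    conj ω₁ * conj ω₃ * ω₅ / (‖ω₃‖ ^ 2 : ℝ))

/-- The right-hand side of the model in the variables `(R, A, w, z, P, Q)`, meaningful
for `R ≠ 0`. -/
def reducedField (ν : ℝ) : State → State := fun (R, A, w, z, P, Q) =>
  ((1 + R) * (P.re - Q.re),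
    -2 * ν * A + 3 / (20 * ν) * A * (w + z),
    -4 * ν * w - 2 / (5 * ν) * w * A,
    -4 * ν * z - 2 / (5 * ν) * z * A,
    -2 * ν * P + z / 2 * (1 - R) - 1 / (5 * ν) * P * A + P * (P.re - Q.re : ℝ)
      + P / 2 * (conj Q - Q / R),
    -2 * ν * Q + w / 2 * (R - 1) - 1 / (5 * ν) * Q * A + Q * (P.re - Q.re : ℝ)
      + Q / 2 * (P / R - conj P))

/-- `X` is a solution on `[0, ∞)` of the system in the variables `(R, A, w, z, P, Q)`, inside
the open region `R > 0`, where the system is regular. -/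
def IsReducedSolution (ν : ℝ) (X : ℝ → State) : Prop :=
  ∀ t, 0 ≤ t → 0 < (X t).1 ∧ HasDerivWithinAt X (reducedField ν (X t)) (Ici 0) t

/-- The fixed point `R = r`, `A = w = z = 0`, `P = Q = 0`. -/
def fixedPoint (r : ℝ) : State := (r, 0)

/-- The graph `{R = f(A, w, z, P, Q)}` over a set `V` of values of `(A, w, z, P, Q)`. -/
def graphOver (f : Transverse → ℝ) (V : Set Transverse) : Set State :=
  {x | x.2 ∈ V ∧ x.1 = f x.2}

/-- The explicit polynomial of degree two in `(A, w, z, Re P, Im P, Re Q, Im Q)` that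
approximates the stable manifold of `fixedPoint r`. -/
def quadraticPart (ν r : ℝ) : Transverse → ℝ := fun (A, w, z, P, Q) =>
  r + (r ^ 2 - 1) / (16 * ν ^ 2) * w + (r ^ 2 - 1) / (16 * ν ^ 2) * z
    - (r + 1) / (2 * ν) * P.re + (r + 1) / (2 * ν) * Q.re
    - (r ^ 2 - 1) / (160 * ν ^ 4) * (A * w) - (r ^ 2 - 1) / (160 * ν ^ 4) * (A * z)
    + (r + 1) / (40 * ν ^ 3) * (A * P.re) - (r + 1) / (40 * ν ^ 3) * (A * Q.re)
    + (r ^ 2 - 1) / (768 * ν ^ 4 * r) * (7 * r ^ 2 + 2 * r + 1) * (w * z)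
    - (r + 1) / (96 * ν ^ 3 * r) * (4 * r ^ 2 - r + 1) * (w * P.re)
    + (r + 1) / (96 * ν ^ 3) * (3 * r + 1) * (w * Q.re)
    + (r ^ 2 - 1) / (768 * ν ^ 4) * (3 * r + 2) * w ^ 2
    - (r + 1) / (96 * ν ^ 3) * (3 * r + 1) * (z * P.re)
    + (r + 1) / (96 * ν ^ 3 * r) * (4 * r ^ 2 - r + 1) * (z * Q.re)
    + (r ^ 2 - 1) / (768 * ν ^ 4) * (3 * r + 2) * z ^ 2
    - (r ^ 2 - 1) / (8 * ν ^ 2 * r) * (P.re * Q.re)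
    - (r + 1) ^ 2 / (8 * ν ^ 2 * r) * (P.im * Q.im)

end

end EightMode

/-! Near the fixed points `A`, `P`, `Q` decay at rate 2ν, `w`, `z` at rate 4ν, and `R` is neutral.
Write A = λa, P = λp, Q = λq, w = λ²w̃, z = λ²z̃ with λ' = -λ(2ν + A/(5ν)). This rate makes w̃ and
z̃ exactly constant, and the derivatives of `R`, a, p, q all carry a factor λ. With λ as independent
variable the system is therefore regular up to λ = 0, which corresponds to t = ∞.

The smooth flow of this system from λ = 0 to a small `l₀ > 0`, followed by the return to the
original variables, is a chart in which the reduced flow is a weighted scaling that fixes the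
`R`-coordinate (`exists_chart`). Each trajectory in the chart thus tends exponentially to the fixed
point named by its first chart coordinate. The stable manifold of `fixedPoint r` is the slice where
that coordinate equals `r`; it is a graph because the transverse part of the chart is invertible on
the slice (`exists_local_stable_manifold`).

For the expansion, `quadraticPart` solves the invariance equation through degree two. The difference
between `R` and `quadraticPart` vanishes at infinity along a trajectory of the manifold, and two
integrations from infinity show that it is cubic (`exists_cubic_bound`).

For generic data the eight-mode model is solved almost explicitly. The pair (ω₅, ω₇) keeps its
direction and shrinks by a factor e^{-L}, so (ω₁, ω₃) is a real amplitude times the orbit of a fixed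
skew linear flow, run with a clock θ of finite total length. The limit of `R` is read off at the
final θ (`exists_isModeSolution_selecting`). This needs both components of the orbit never to
vanish. A vanishing component is two real conditions against one time parameter, hence a null event
(`volume_exists_couplingFlow_mem_range`). -/

/-! ### Composition operators on spaces of curves -/

section Superposition

universe u v

variable {K : Type v} [TopologicalSpace K] [CompactSpace K]
variable {E : Type u} [NormedAddCommGroup E] [NormedSpace ℝ E]

/-- Pointwise application of a continuous family of continuous linear maps, as a continuous
bilinear map. -/
noncomputable def pointwiseApply (K : Type v) [TopologicalSpace K] [CompactSpace K]
    (E F : Type u) [NormedAddCommGroup E] [NormedSpace ℝ E]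
    [NormedAddCommGroup F] [NormedSpace ℝ F] :
    C(K, E →L[ℝ] F) →L[ℝ] C(K, E) →L[ℝ] C(K, F) :=
  LinearMap.mkContinuous₂
    (LinearMap.mk₂ ℝ
      (fun (A : C(K, E →L[ℝ] F)) (h : C(K, E)) =>
        (⟨fun t => A t (h t), A.continuous.clm_apply h.continuous⟩ : C(K, F)))
      (fun A B h => by ext t; simp) (fun c A h => by ext t; simp)
      (fun A h k => by ext t; simp) (fun c A h => by ext t; simp)) 1
    (fun A h => by
      rw [one_mul]
      refine (ContinuousMap.norm_le _ (by positivity)).2 fun t => ?_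
      refine ((A t).le_opNorm (h t)).trans ?_
      gcongr
      · exact A.norm_coe_le_norm t
      · exact h.norm_coe_le_norm t)

@[simp]
theorem pointwiseApply_apply {F : Type u} [NormedAddCommGroup F] [NormedSpace ℝ F]
    (A : C(K, E →L[ℝ] F)) (h : C(K, E)) (t : K) : pointwiseApply K E F A h t = A t (h t) :=
  rfl

/-- The remainder is estimated pointwise by the mean value inequality. Compactness of the range of
`X` gives one radius `δ` valid for all `t`, so the estimate holds in the sup norm. -/
theorem hasFDerivAt_continuousMap_comp {F : Type u} [NormedAddCommGroup F] [NormedSpace ℝ F]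
    (G : C(E, F)) (G' : C(E, E →L[ℝ] F)) (hG : ∀ x, HasFDerivAt G (G' x) x) (X : C(K, E)) :
    HasFDerivAt (fun Y : C(K, E) => G.comp Y) (pointwiseApply K E F (G'.comp X)) X := by
  rw [hasFDerivAt_iff_isLittleO, isLittleO_iff]
  intro c hc
  have hcpt : IsCompact (range X) := isCompact_range X.continuous
  have hu := hcpt.uniformContinuousAt_of_continuousAt G' (fun a _ => G'.continuous.continuousAt)
    (Metric.dist_mem_uniformity hc)
  obtain ⟨δ, hδ, hδ'⟩ := Metric.mem_uniformity_dist.1 hu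
  filter_upwards [Metric.ball_mem_nhds X hδ] with Y hY
  rw [mem_ball_iff_norm] at hY
  refine (ContinuousMap.norm_le _ (by positivity)).2 fun t => ?_
  have hYt : ‖Y t - X t‖ ≤ ‖Y - X‖ := (Y - X).norm_coe_le_norm t
  have key := (convex_ball (X t) δ).norm_image_sub_le_of_norm_hasFDerivWithin_le' (𝕜 := ℝ)
    (f := G) (f' := G') (φ := G' (X t)) (C := c) (x := X t) (y := Y t)
    (fun x _ => (hG x).hasFDerivWithinAt)
    (fun x hx => by
      have := @hδ' (X t) x (by rwa [dist_comm]) (mem_range_self t)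
      rw [← dist_eq_norm, dist_comm]
      exact le_of_lt this)
    (Metric.mem_ball_self hδ) (by rw [mem_ball_iff_norm]; exact hYt.trans_lt hY)
  refine (le_of_eq ?_).trans (key.trans (by gcongr))
  simp

/-- Induction on `n`: the derivative is a bounded linear operator applied to the composition
operator of `G'`. The target space varies because `G'` takes values in linear maps. -/
theorem contDiff_continuousMap_comp_nat (n : ℕ) {F : Type u} [NormedAddCommGroup F]
    [NormedSpace ℝ F] (G : C(E, F)) (hG : ContDiff ℝ n G) :
    ContDiff ℝ n (fun Y : C(K, E) => G.comp Y) := by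
  induction n generalizing F with
  | zero =>
    exact contDiff_zero.2 (ContinuousMap.continuous_postcomp G)
  | succ n ih =>
    push_cast at hG ⊢
    obtain ⟨G', hG', hd⟩ := contDiff_succ_iff_hasFDerivAt.1 hG
    refine contDiff_succ_iff_hasFDerivAt.2 ⟨fun X => pointwiseApply K E F
      ((⟨G', hG'.continuous⟩ : C(E, E →L[ℝ] F)).comp X), ?_, fun X =>
        hasFDerivAt_continuousMap_comp G ⟨G', hG'.continuous⟩ hd X⟩
    exact (pointwiseApply K E F).contDiff.comp (ih ⟨G', hG'.continuous⟩ hG')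

/-- The superposition operator of a smooth map is smooth on spaces of continuous functions. -/
theorem contDiff_continuousMap_comp {F : Type u} [NormedAddCommGroup F] [NormedSpace ℝ F]
    (G : C(E, F)) (hG : ContDiff ℝ ∞ G) : ContDiff ℝ ∞ (fun Y : C(K, E) => G.comp Y) :=
  contDiff_infty.2 fun n => contDiff_continuousMap_comp_nat n G (contDiff_infty.1 hG n)

end Superposition

/-! ### Smooth local inverses -/

section LocalInverse

variable {E F : Type*} [NormedAddCommGroup E] [NormedSpace ℝ E] [CompleteSpace E]
  [NormedAddCommGroup F] [NormedSpace ℝ F]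

/-- The inverse function theorem for maps of class `C^∞`, with a smooth inverse on the whole target
of the local inverse. -/
theorem exists_openPartialHomeomorph_contDiffOn_symm {f : E → F} {U : Set E} (hU : IsOpen U)
    (hf : ContDiffOn ℝ ∞ f U) {a : E} (ha : a ∈ U) (f' : E ≃L[ℝ] F)
    (hf' : HasFDerivAt f (f' : E →L[ℝ] F) a) :
    ∃ e : OpenPartialHomeomorph E F, a ∈ e.source ∧ e.source ⊆ U ∧ (∀ x, e x = f x) ∧
      ContDiffOn ℝ ∞ e.symm e.target := by
  have hfa : ContDiffAt ℝ ∞ f a := hf.contDiffAt (hU.mem_nhds ha)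
  set e₀ := hfa.toOpenPartialHomeomorph f hf' (by simp) with he₀
  have he₀c : ∀ x, e₀ x = f x := fun x => rfl
  -- Restricting to the open set where the derivative is invertible makes the inverse smooth at
  -- every point of the target, not only near the image of `a`.
  have hO : IsOpen (U ∩ fderiv ℝ f ⁻¹' range ((↑) : (E ≃L[ℝ] F) → E →L[ℝ] F)) :=
    (hf.continuousOn_fderiv_of_isOpen hU (by simp)).isOpen_inter_preimage hU
      ContinuousLinearEquiv.isOpen
  refine ⟨e₀.restrOpen _ hO, ?_, ?_, ?_, ?_⟩
  · rw [OpenPartialHomeomorph.restrOpen_source]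
    exact ⟨hfa.mem_toOpenPartialHomeomorph_source hf' (by simp), ha, f', hf'.fderiv.symm⟩
  · rw [OpenPartialHomeomorph.restrOpen_source]
    exact fun x hx => hx.2.1
  · exact fun x => rfl
  · intro y hy
    have hx := (e₀.restrOpen _ hO).map_target hy
    rw [OpenPartialHomeomorph.restrOpen_source] at hx
    obtain ⟨-, hxU, g, hg⟩ := hx
    have hfx := hf.contDiffAt (hU.mem_nhds hxU)
    refine ((e₀.restrOpen _ hO).contDiffAt_symm (f₀' := g) hy ?_ hfx).contDiffWithinAt
    rw [hg]
    exact (hfx.differentiableAt (by simp)).hasFDerivAt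

end LocalInverse

/-! ### Smooth local flows by the inverse function theorem -/

section Flow

open unitInterval

variable {E : Type*} [NormedAddCommGroup E] [NormedSpace ℝ E] [CompleteSpace E]

/-- The primitive vanishing at `0`, as a continuous linear operator on curves. -/
noncomputable def primitiveCLM (E : Type*) [NormedAddCommGroup E] [NormedSpace ℝ E]
    [CompleteSpace E] : C(I, E) →L[ℝ] C(I, E) :=
  LinearMap.mkContinuous
    { toFun := fun x => ⟨fun t => ∫ s in (0 : ℝ)..t, IccExtend zero_le_one x s,
        (intervalIntegral.continuous_primitive
          (fun _ _ => (x.continuous.Icc_extend' : Continuous _).intervalIntegrable _ _) 0).comp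
          continuous_subtype_val⟩
      map_add' := fun x y => by
        ext t
        exact intervalIntegral.integral_add
          ((x.continuous.Icc_extend' : Continuous _).intervalIntegrable _ _)
          ((y.continuous.Icc_extend' : Continuous _).intervalIntegrable _ _)
      map_smul' := fun c x => by
        ext t
        exact intervalIntegral.integral_smul c _ } 1
    (fun x => by
      rw [one_mul]
      refine (ContinuousMap.norm_le _ (norm_nonneg _)).2 fun t => ?_
      have h := intervalIntegral.norm_integral_le_of_norm_le_const (a := (0 : ℝ)) (b := t)
        (f := IccExtend zero_le_one x) (C := ‖x‖) (fun s _ => x.norm_coe_le_norm _)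
      refine h.trans ?_
      rw [sub_zero, abs_of_nonneg t.2.1]
      exact mul_le_of_le_one_right (norm_nonneg _) t.2.2)

theorem primitiveCLM_apply (x : C(I, E)) (t : I) :
    primitiveCLM E x t = ∫ s in (0 : ℝ)..t, IccExtend zero_le_one x s :=
  rfl

end Flow

section Flow

open unitInterval

variable {E : Type*} [NormedAddCommGroup E] [NormedSpace ℝ E] [CompleteSpace E]

/-- Substitution in the integral: passing to an initial segment of a curve amounts to shortening its
time parameter. -/
theorem primitiveCLM_mul (s : I) {x y : C(I, E)} (hxy : ∀ τ, y τ = x (s * τ)) (τ : I) :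
    primitiveCLM E x (s * τ) = (s : ℝ) • primitiveCLM E y τ := by
  rw [primitiveCLM_apply, primitiveCLM_apply]
  have h3 := intervalIntegral.smul_integral_comp_mul_left (a := 0) (b := (τ : ℝ))
    (IccExtend zero_le_one x) (s : ℝ)
  rw [mul_zero] at h3
  rw [Icc.coe_mul, ← h3]
  congr 1
  refine intervalIntegral.integral_congr fun u hu => ?_
  rw [uIcc_of_le τ.2.1] at hu
  have hu1 : u ∈ I := ⟨hu.1, hu.2.trans τ.2.2⟩
  have hu2 : (s : ℝ) * u ∈ I := unitInterval.mul_mem s.2 hu1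
  simp only [IccExtend_of_mem _ _ hu1, IccExtend_of_mem _ _ hu2, hxy]
  rfl

/-- Smooth local flow of a globally smooth vector field, from the inverse function theorem in the
space of curves. -/
theorem exists_local_flow_of_contDiff (G : C(E, E)) (hG : ContDiff ℝ ∞ G) (x₀ : E)
    {ρ : ℝ} (hρ : 0 < ρ) :
    ∃ φ : ℝ → E → E, ∃ ε > 0, ∃ δ > 0,
      ContDiffOn ℝ ∞ (fun p : ℝ × E => φ p.1 p.2) (Ioo (-ε) ε ×ˢ Metric.ball x₀ δ) ∧
      ∀ x ∈ Metric.ball x₀ δ, φ 0 x = x ∧ ∀ t ∈ Ioo (-ε) ε, φ t x ∈ Metric.ball x₀ ρ ∧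
        HasDerivAt (fun s => φ s x) (G (φ t x)) t := by
  set const : E →L[ℝ] C(I, E) := ContinuousLinearMap.const ℝ I with hconst
  have const_apply : ∀ x t, const x t = x := fun x t => rfl
  set J := primitiveCLM E with hJ
  -- With time rescaled to the unit interval, a solution over time `t` from `x` is a curve `X` with
  -- H(t, X) = (t, x). At t = 0 the derivative of `H` is (τ, h) ↦ (τ, h - τ J(G x₀)), which is
  -- triangular and so invertible whatever the size of `G`.
  set H : ℝ × C(I, E) → ℝ × C(I, E) := fun p => (p.1, p.2 - p.1 • J (G.comp p.2)) with hH
  have hHs : ContDiff ℝ ∞ H := by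
    refine contDiff_fst.prodMk (contDiff_snd.sub (contDiff_fst.smul ?_))
    exact J.contDiff.comp ((contDiff_continuousMap_comp G hG).comp contDiff_snd)
  set L : (ℝ × C(I, E)) ≃L[ℝ] ℝ × C(I, E) :=
    ContinuousLinearEquiv.skewProd (ContinuousLinearEquiv.refl ℝ ℝ)
      (ContinuousLinearEquiv.refl ℝ C(I, E))
      (-(ContinuousLinearMap.id ℝ ℝ).smulRight (J (G.comp (const x₀)))) with hL
  have hHd : HasFDerivAt H (L : (ℝ × C(I, E)) →L[ℝ] ℝ × C(I, E)) (0, const x₀) := by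
    have hN : HasFDerivAt (fun p : ℝ × C(I, E) => J (G.comp p.2))
        (fderiv ℝ (fun p : ℝ × C(I, E) => J (G.comp p.2)) (0, const x₀)) (0, const x₀) :=
      ((J.contDiff.comp ((contDiff_continuousMap_comp G hG).comp contDiff_snd)).differentiable
        (by simp)).differentiableAt.hasFDerivAt
    have h1 : HasFDerivAt (fun p : ℝ × C(I, E) => p.1) (ContinuousLinearMap.fst ℝ ℝ C(I, E))
      (0, const x₀) := hasFDerivAt_fst
    have h2 := h1.prodMk ((hasFDerivAt_snd (𝕜 := ℝ) (p := ((0 : ℝ), const x₀))).sub (h1.smul hN))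
    refine h2.congr_fderiv ?_
    ext p <;> simp [hL]
  obtain ⟨e, hae, hsub, hee, hsymm⟩ := exists_openPartialHomeomorph_contDiffOn_symm
    (Metric.isOpen_ball (x := ((0 : ℝ), const x₀)) (ε := ρ)) hHs.contDiffOn
    (Metric.mem_ball_self hρ) L hHd
  -- restrict the local inverse to a ball
  obtain ⟨η, hη, hηe⟩ := Metric.isOpen_iff.1 e.open_source _ hae
  set e' := e.restrOpen (Metric.ball ((0 : ℝ), const x₀) η) Metric.isOpen_ball with he'
  have hsrc : e'.source = Metric.ball ((0 : ℝ), const x₀) η := by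
    rw [he', OpenPartialHomeomorph.restrOpen_source]
    exact inter_eq_right.2 hηe
  have hee' : ∀ p, e' p = H p := hee
  have hsymm' : ContDiffOn ℝ ∞ e'.symm e'.target := by
    refine ContDiffOn.mono (s := e.target) hsymm ?_
    rw [he']
    intro y hy
    have := e'.map_target hy
    rw [hsrc] at this
    have h3 := e.map_source (hηe this)
    have h4 : e (e'.symm y) = y := e'.right_inv hy
    rwa [h4] at h3
  have hbase : ((0 : ℝ), const x₀) ∈ e'.target := by
    have h := e'.map_source (x := ((0 : ℝ), const x₀)) (by rw [hsrc]; exact Metric.mem_ball_self hη)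
    rw [hee'] at h
    simpa [hH] using h
  clear_value e' L
  set ι : ℝ × E → ℝ × C(I, E) := fun p => (p.1, const p.2) with hι
  have hιs : ContDiff ℝ ∞ ι := contDiff_fst.prodMk (const.contDiff.comp contDiff_snd)
  obtain ⟨ε, hε, hεt⟩ := Metric.isOpen_iff.1 (e'.open_target.preimage hιs.continuous) (0, x₀) hbase
  have hmem : ∀ t ∈ Ioo (-ε) ε, ∀ x ∈ Metric.ball x₀ ε, ((t, const x) : ℝ × C(I, E)) ∈ e'.target := by
    intro t ht x hx
    refine hεt (a := (t, x)) ?_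
    rw [Metric.mem_ball, Prod.dist_eq]
    refine max_lt ?_ hx
    rw [dist_zero_right]
    exact abs_lt.2 ht
  obtain ⟨X, hX⟩ : ∃ X : ℝ → E → C(I, E), ∀ t x, (e'.symm (t, const x)).2 = X t x :=
    ⟨_, fun _ _ => rfl⟩
  have hXfst : ∀ t ∈ Ioo (-ε) ε, ∀ x ∈ Metric.ball x₀ ε,
      e'.symm (t, const x) = (t, X t x) ∧ ((t, X t x) : ℝ × C(I, E)) ∈ Metric.ball ((0 : ℝ), const x₀) η ∧
      X t x - t • J (G.comp (X t x)) = const x := by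
    intro t ht x hx
    have h1 := e'.right_inv (hmem t ht x hx)
    rw [hee'] at h1
    have h2 : (e'.symm (t, const x)).1 = t := congrArg Prod.fst h1
    have h3 := congrArg Prod.snd h1
    simp only [hH] at h3
    rw [h2, hX] at h3
    have h4 : e'.symm (t, const x) = (t, X t x) := Prod.ext h2 (hX t x)
    refine ⟨h4, ?_, h3⟩
    rw [← h4, ← hsrc]
    exact e'.map_target (hmem t ht x hx)
  -- The curve τ ↦ X t x (sτ) solves the equation with time st. It stays in the ball on which `H` is
  -- injective, so it is the curve `X (s * t) x`.
  have hresc : ∀ t ∈ Ioo (-ε) ε, ∀ x ∈ Metric.ball x₀ ε, ∀ s : I,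
      X (s * t) x 1 = X t x s := by
    intro t ht x hx s
    obtain ⟨-, hball, heq⟩ := hXfst t ht x hx
    set Y : C(I, E) := ⟨fun τ => X t x (s * τ), by fun_prop⟩ with hY
    have hst : (s : ℝ) * t ∈ Ioo (-ε) ε := by
      refine abs_lt.1 ?_
      rw [abs_mul, abs_of_nonneg s.2.1]
      exact (mul_le_of_le_one_left (abs_nonneg _) s.2.2).trans_lt (abs_lt.2 ht)
    have hYb : (((s : ℝ) * t, Y) : ℝ × C(I, E)) ∈ e'.source := by
      rw [Metric.mem_ball, Prod.dist_eq, max_lt_iff] at hball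
      rw [hsrc, Metric.mem_ball, Prod.dist_eq, max_lt_iff]
      refine ⟨?_, ?_⟩
      · have h1 := hball.1
        rw [dist_zero_right] at h1 ⊢
        change ‖(s : ℝ) * t‖ < η
        rw [norm_mul, Real.norm_of_nonneg s.2.1]
        exact (mul_le_of_le_one_left (norm_nonneg _) s.2.2).trans_lt h1
      · refine (ContinuousMap.dist_lt_iff hη).2 fun τ => ?_
        exact (ContinuousMap.dist_apply_le_dist (f := X t x) (g := const x₀) (s * τ)).trans_lt hball.2
    have hYeq : H ((s : ℝ) * t, Y) = ((s : ℝ) * t, const x) := by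
      refine Prod.ext rfl ?_
      ext τ
      have h1 := congrArg (fun Z : C(I, E) => Z (s * τ)) heq
      simp only [hH, ContinuousMap.sub_apply, ContinuousMap.smul_apply, const_apply] at h1 ⊢
      rw [← h1]
      have h2 : t • J (G.comp (X t x)) (s * τ) = ((s : ℝ) * t) • J (G.comp Y) τ := by
        rw [mul_comm (s : ℝ), mul_smul, hJ,
          primitiveCLM_mul s (x := G.comp (X t x)) (y := G.comp Y) fun _ => rfl]
      rw [h2]
      rfl
    have h5 := e'.left_inv hYb
    rw [hee', hYeq] at h5
    have h6 := congrArg Prod.snd h5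
    rw [hX] at h6
    rw [h6]
    simp [hY]
  have hXs : ContDiffOn ℝ ∞ (fun p : ℝ × E => X p.1 p.2 1) (Ioo (-ε) ε ×ˢ Metric.ball x₀ ε) := by
    have h1 : ContDiffOn ℝ ∞ (fun p : ℝ × E => e'.symm (ι p)) (Ioo (-ε) ε ×ˢ Metric.ball x₀ ε) :=
      hsymm'.comp hιs.contDiffOn fun p hp => hmem p.1 hp.1 p.2 hp.2
    refine ((ContinuousMap.evalCLM ℝ (1 : I)).contDiff.comp_contDiffOn
      (contDiff_snd.comp_contDiffOn h1)).congr fun p _ => ?_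
    rw [← hX]
    rfl
  refine ⟨fun t x => X t x 1, ε, hε, ε, hε, ?_, fun x hx => ⟨?_, fun t ht => ⟨?_, ?_⟩⟩⟩
  · exact hXs
  · have h := (hXfst 0 ⟨by linarith, hε⟩ x hx).2.2
    rw [zero_smul, sub_zero] at h
    change X 0 x 1 = x
    rw [h]
    rfl
  · have h1 := (hXfst t ht x hx)
    have h2 : ((t, X t x) : ℝ × C(I, E)) ∈ Metric.ball ((0 : ℝ), const x₀) ρ :=
      hsub (hηe h1.2.1)
    rw [Metric.mem_ball, Prod.dist_eq, max_lt_iff] at h2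
    exact (ContinuousMap.dist_apply_le_dist (1 : I)).trans_lt h2.2
  -- At the endpoint 1, the reparametrization identity turns the equation for curves into the usual
  -- integral equation in `t`.
  · have hint : ∀ t ∈ Ioo (-ε) ε, X t x 1 = x + ∫ s in (0 : ℝ)..t, G (X s x 1) := by
      intro t ht
      have h1 := congrArg (fun Z : C(I, E) => Z 1) (hXfst t ht x hx).2.2
      simp only [ContinuousMap.sub_apply, ContinuousMap.smul_apply, const_apply] at h1
      have h3 := intervalIntegral.smul_integral_comp_mul_right (a := 0) (b := 1)
          (fun s => G (X s x 1)) t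
      rw [zero_mul, one_mul] at h3
      have h4 : ∫ s in (0 : ℝ)..(1 : I), IccExtend zero_le_one (G.comp (X t x)) s =
          ∫ s in (0 : ℝ)..1, G (X (s * t) x 1) := by
        refine intervalIntegral.integral_congr fun u hu => ?_
        simp only [Icc.coe_one] at hu
        rw [uIcc_of_le zero_le_one] at hu
        rw [IccExtend_of_mem _ _ hu, hresc t ht x hx ⟨u, hu⟩]
        rfl
      rw [hJ, primitiveCLM_apply, h4, h3, sub_eq_iff_eq_add] at h1
      exact h1
    have hcont : ContinuousOn (fun s => G (X s x 1)) (Ioo (-ε) ε) := by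
      refine G.continuous.comp_continuousOn (hXs.continuousOn.comp (f := fun s : ℝ => (s, x))
        (by fun_prop) fun s hs => ⟨hs, hx⟩)
    have hd : HasDerivAt (fun t => x + ∫ s in (0 : ℝ)..t, G (X s x 1)) (G (X t x 1)) t := by
      refine HasDerivAt.const_add _ (intervalIntegral.integral_hasDerivAt_right ?_ ?_ ?_)
      · refine (hcont.mono ?_).intervalIntegrable
        exact (ordConnected_Ioo.uIcc_subset ⟨by linarith, hε⟩ ht)
      · exact hcont.stronglyMeasurableAtFilter isOpen_Ioo t ht
      · exact hcont.continuousAt (isOpen_Ioo.mem_nhds ht)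
    refine hd.congr_of_eventuallyEq ?_
    filter_upwards [isOpen_Ioo.mem_nhds ht] with s hs using hint s hs

/-- Smooth local flow of a vector field of class `C^∞` on an open set. -/
theorem exists_local_flow [FiniteDimensional ℝ E] {G : E → E} {U : Set E} (hU : IsOpen U)
    (hG : ContDiffOn ℝ ∞ G U) {x₀ : E} (hx₀ : x₀ ∈ U) :
    ∃ φ : ℝ → E → E, ∃ ε > 0, ∃ δ > 0,
      ContDiffOn ℝ ∞ (fun p : ℝ × E => φ p.1 p.2) (Ioo (-ε) ε ×ˢ Metric.ball x₀ δ) ∧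
      ∀ x ∈ Metric.ball x₀ δ, φ 0 x = x ∧ ∀ t ∈ Ioo (-ε) ε, φ t x ∈ U ∧
        HasDerivAt (fun s => φ s x) (G (φ t x)) t := by
  obtain ⟨R, hR, hRU⟩ := Metric.isOpen_iff.1 hU x₀ hx₀
  -- The cut-off equals 1 on the ball of radius R/3, and the flow of the cut-off field is confined
  -- to that ball, so it solves the original equation.
  set χ : ContDiffBump x₀ := ⟨R / 3, R / 2, by positivity, by linarith⟩ with hχ
  have hsm : ContDiff ℝ ∞ (fun x => χ x • G x) := by
    rw [contDiff_iff_contDiffAt]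
    intro x
    by_cases hx : x ∈ U
    · exact χ.contDiff.contDiffAt.smul (hG.contDiffAt (hU.mem_nhds hx))
    · have hxs : x ∉ tsupport χ := by
        rw [χ.tsupport_eq]
        intro h
        exact hx (hRU (Metric.closedBall_subset_ball (by simp only [hχ]; linarith) h))
      have h0 : (fun x => χ x • G x) =ᶠ[𝓝 x] fun _ => 0 := by
        filter_upwards [(isClosed_tsupport χ).isOpen_compl.mem_nhds hxs] with y hy
        rw [image_eq_zero_of_notMem_tsupport hy, zero_smul]
      exact contDiffAt_const.congr_of_eventuallyEq h0
  obtain ⟨φ, ε, hε, δ, hδ, hφ, h⟩ := exists_local_flow_of_contDiff ⟨_, hsm.continuous⟩ hsm x₀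
    (ρ := R / 3) (by positivity)
  refine ⟨φ, ε, hε, δ, hδ, hφ, fun x hx => ⟨(h x hx).1, fun t ht => ?_⟩⟩
  obtain ⟨h1, h2⟩ := (h x hx).2 t ht
  refine ⟨hRU (Metric.ball_subset_ball (by linarith) h1), ?_⟩
  have h3 : χ (φ t x) = 1 := χ.one_of_mem_closedBall (Metric.ball_subset_closedBall h1)
  simpa [h3] using h2

end Flow

/-! ### Scalar equations and exponential decay -/

section ScalarODE

/-- An autonomous scalar equation `L' = h(L)` whose right-hand side is continuous and pinched
between two positive constants has a global solution. -/
theorem exists_hasDerivAt_of_pinched {h : ℝ → ℝ} (hh : Continuous h) {c K : ℝ} (hc : 0 < c)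
    (hl : ∀ x, c ≤ h x) (hu : ∀ x, h x ≤ K) :
    ∃ L : ℝ → ℝ, L 0 = 0 ∧ (∀ t, HasDerivAt L (h (L t)) t) ∧ ∀ t, 0 ≤ t → c * t ≤ L t := by
  have hpos : ∀ x, 0 < h x := fun x => hc.trans_le (hl x)
  have hK : 0 < K := hc.trans_le ((hl 0).trans (hu 0))
  have hcont : Continuous fun x => (h x)⁻¹ := hh.inv₀ fun x => (hpos x).ne'
  -- Separation of variables: `T x` is the time needed to reach `x`, and the solution is its
  -- inverse. The upper bound `K` makes `T` surjective, so the solution is global.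
  set T : ℝ → ℝ := fun x => ∫ s in (0 : ℝ)..x, (h s)⁻¹ with hT
  have hTd : ∀ x, HasDerivAt T (h x)⁻¹ x := fun x => hcont.integral_hasStrictDerivAt 0 x |>.hasDerivAt
  have hT0 : T 0 = 0 := by simp [hT]
  have hmono : StrictMono T := strictMono_of_hasDerivAt_pos hTd fun x => inv_pos.2 (hpos x)
  have hmono' : Monotone fun x => T x - K⁻¹ * x := by
    refine monotone_of_hasDerivAt_nonneg (f' := fun x => (h x)⁻¹ - K⁻¹ * 1)
      (fun x => (hTd x).sub ((hasDerivAt_id x).const_mul _)) fun x => ?_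
    have := inv_anti₀ (hpos x) (hu x)
    simpa using this
  have hcontT : Continuous T := continuous_iff_continuousAt.2 fun x => (hTd x).continuousAt
  have hsurj : Function.Surjective T := by
    refine hcontT.surjective ?_ ?_
    · refine tendsto_atTop_mono' _ ?_ (tendsto_id.const_mul_atTop (inv_pos.2 hK))
      filter_upwards [eventually_ge_atTop 0] with x hx
      have := hmono' hx
      simp only [hT0, mul_zero, sub_zero] at this
      simp only [id]; linarith
    · refine tendsto_atBot_mono' _ ?_ (tendsto_id.const_mul_atBot (inv_pos.2 hK))
      filter_upwards [eventually_le_atBot 0] with x hx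
      have := hmono' hx
      simp only [hT0, mul_zero, sub_zero] at this
      simp only [id]; linarith
  set e := hmono.orderIsoOfSurjective T hsurj with he
  have heT : ∀ x, e x = T x := fun x => rfl
  have hL0 : e.symm 0 = 0 := by rw [OrderIso.symm_apply_eq, heT, hT0]
  have hLd : ∀ t, HasDerivAt e.symm (h (e.symm t)) t := by
    intro t
    have h1 := HasDerivAt.of_local_left_inverse (f := T) (g := e.symm) (a := t)
      e.symm.continuous.continuousAt (hTd (e.symm t)) (inv_ne_zero (hpos _).ne')
      (Eventually.of_forall fun y => e.apply_symm_apply y)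
    rwa [inv_inv] at h1
  refine ⟨e.symm, hL0, hLd, fun t ht => ?_⟩
  have hm : Monotone fun x => e.symm x - c * x := by
    refine monotone_of_hasDerivAt_nonneg (f' := fun x => h (e.symm x) - c * 1)
      (fun x => (hLd x).sub ((hasDerivAt_id x).const_mul _)) fun x => ?_
    have := hl (e.symm x)
    simpa using this
  have := hm ht
  simp only [hL0, mul_zero, sub_zero] at this
  linarith

/-- A function that vanishes at infinity and whose derivative decays exponentially decays at the
same rate. -/
theorem abs_le_of_abs_deriv_le_exp {h h' : ℝ → ℝ} {B c : ℝ} (hc : 0 < c)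
    (hd : ∀ t, 0 ≤ t → HasDerivWithinAt h (h' t) (Ici 0) t)
    (hb : ∀ t, 0 ≤ t → |h' t| ≤ B * Real.exp (-c * t)) (hlim : Tendsto h atTop (𝓝 0)) {t : ℝ}
    (ht : 0 ≤ t) : |h t| ≤ B / c * Real.exp (-c * t) := by
  have hexp : ∀ t, HasDerivAt (fun s => B / c * Real.exp (-c * s)) (-(B * Real.exp (-c * t))) t := by
    intro t
    have h1 := (((hasDerivAt_id t).const_mul (-c)).exp.const_mul (B / c))
    refine h1.congr_deriv ?_
    simp only [id]
    field_simp
  have hexplim : Tendsto (fun s => B / c * Real.exp (-c * s)) atTop (𝓝 0) := by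
    have h1 : Tendsto (fun s => -c * s) atTop atBot :=
      tendsto_id.const_mul_atTop_of_neg (by linarith)
    simpa using (Real.tendsto_exp_atBot.comp h1).const_mul (B / c)
  -- The sum of `k` and the exponential is nonincreasing with limit 0, hence nonnegative. Applied to
  -- `h` and `-h`, this bounds both signs.
  have key : ∀ k k' : ℝ → ℝ, (∀ t, 0 ≤ t → HasDerivWithinAt k (k' t) (Ici 0) t) →
      (∀ t, 0 ≤ t → k' t ≤ B * Real.exp (-c * t)) → Tendsto k atTop (𝓝 0) →
      0 ≤ k t + B / c * Real.exp (-c * t) := by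
    intro k k' hk hk' hkl
    have hD : ∀ s, 0 ≤ s → HasDerivWithinAt (fun s => k s + B / c * Real.exp (-c * s))
        (k' s + -(B * Real.exp (-c * s))) (Ici 0) s := fun s hs => (hk s hs).add (hexp s).hasDerivWithinAt
    have hanti : AntitoneOn (fun s => k s + B / c * Real.exp (-c * s)) (Ici 0) := by
      refine antitoneOn_of_hasDerivWithinAt_nonpos (convex_Ici 0)
        (f' := fun s => k' s + -(B * Real.exp (-c * s)))
        (fun s hs => (hD s hs).continuousWithinAt) (fun s hs => ?_) fun s hs => ?_
      · rw [interior_Ici] at hs ⊢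
        exact (hD s (mem_Ioi.1 hs).le).mono Ioi_subset_Ici_self
      · rw [interior_Ici] at hs
        linarith [hk' s (mem_Ioi.1 hs).le]
    have hl : Tendsto (fun s => k s + B / c * Real.exp (-c * s)) atTop (𝓝 0) := by
      simpa using hkl.add hexplim
    refine le_of_tendsto hl ?_
    filter_upwards [eventually_ge_atTop t] with s hs
    exact hanti ht (ht.trans hs) hs
  have h1 := key h h' hd (fun s hs => (le_abs_self _).trans (hb s hs)) hlim
  have h2 := key (fun s => -h s) (fun s => -h' s) (fun s hs => (hd s hs).neg)
    (fun s hs => (neg_le_abs _).trans (hb s hs)) (by simpa using hlim.neg)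
  rw [abs_le]
  constructor <;> linarith

end ScalarODE

/-! ### Forward uniqueness -/

section Uniqueness

variable {E : Type*} [NormedAddCommGroup E] [NormedSpace ℝ E]

/-- Forward uniqueness for an autonomous equation whose right-hand side is of class `C¹` at the
points of a set containing both solutions. -/
theorem eq_of_forward_solutions {v : E → E} {Ω : Set E}
    (hv : ∀ x ∈ Ω, ContDiffAt ℝ 1 v x) {X Y : ℝ → E}
    (hX : ∀ t, 0 ≤ t → X t ∈ Ω ∧ HasDerivWithinAt X (v (X t)) (Ici 0) t)
    (hY : ∀ t, 0 ≤ t → Y t ∈ Ω ∧ HasDerivWithinAt Y (v (Y t)) (Ici 0) t) (h0 : X 0 = Y 0)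
    {t : ℝ} (ht : 0 ≤ t) : X t = Y t := by
  have hcX : ContinuousOn X (Icc 0 t) := fun s hs =>
    ((hX s hs.1).2.continuousWithinAt).mono Icc_subset_Ici_self
  have hcY : ContinuousOn Y (Icc 0 t) := fun s hs =>
    ((hY s hs.1).2.continuousWithinAt).mono Icc_subset_Ici_self
  -- Both trajectories over `[0, t]` form a compact set, on which a locally Lipschitz field is
  -- Lipschitz.
  set S : Set E := X '' Icc 0 t ∪ Y '' Icc 0 t with hS
  have hSc : IsCompact S := (isCompact_Icc.image_of_continuousOn hcX).union
    (isCompact_Icc.image_of_continuousOn hcY)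
  have hSΩ : S ⊆ Ω := by
    rintro _ (⟨s, hs, rfl⟩ | ⟨s, hs, rfl⟩)
    · exact (hX s hs.1).1
    · exact (hY s hs.1).1
  have hloc : LocallyLipschitzOn S v := fun x hx => by
    obtain ⟨K, T, hT, hK⟩ := (hv x (hSΩ hx)).exists_lipschitzOnWith
    exact ⟨K, T, mem_nhdsWithin_of_mem_nhds hT, hK⟩
  obtain ⟨K, hK⟩ := hloc.exists_lipschitzOnWith_of_compact hSc
  refine ODE_solution_unique_of_mem_Icc_right (v := fun _ => v) (s := fun _ => S) (K := K)
    (fun _ _ => hK) hcX (fun s hs => (hX s hs.1).2.mono (Ici_subset_Ici.2 hs.1))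
    (fun s hs => Or.inl ⟨s, ⟨hs.1, hs.2.le⟩, rfl⟩) hcY
    (fun s hs => (hY s hs.1).2.mono (Ici_subset_Ici.2 hs.1))
    (fun s hs => Or.inr ⟨s, ⟨hs.1, hs.2.le⟩, rfl⟩) h0 (right_mem_Icc.2 ht)

end Uniqueness

/-! ### Regularity and uniqueness for the reduced system -/

namespace EightMode

section

variable {E : Type*} [NormedAddCommGroup E] [NormedSpace ℝ E] {n : WithTop ℕ∞} {x : E}

@[fun_prop]
theorem ContDiffAt.complex_re {f : E → ℂ} (hf : ContDiffAt ℝ n f x) :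
    ContDiffAt ℝ n (fun y => (f y).re) x :=
  Complex.reCLM.contDiff.contDiffAt.comp x hf

@[fun_prop]
theorem ContDiffAt.complex_ofReal {f : E → ℝ} (hf : ContDiffAt ℝ n f x) :
    ContDiffAt ℝ n (fun y => (f y : ℂ)) x :=
  Complex.ofRealCLM.contDiff.contDiffAt.comp x hf

@[fun_prop]
theorem ContDiffAt.complex_conj {f : E → ℂ} (hf : ContDiffAt ℝ n f x) :
    ContDiffAt ℝ n (fun y => conj (f y)) x :=
  Complex.conjCLE.contDiff.contDiffAt.comp x hf

end

theorem contDiffAt_reducedField (ν : ℝ) {x : State} (hx : x.1 ≠ 0) :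
    ContDiffAt ℝ ∞ (reducedField ν) x := by
  have hx' : ((x.1 : ℝ) : ℂ) ≠ 0 := by exact_mod_cast hx
  have hinv : ContDiffAt ℝ ∞ (fun y : State => ((y.1 : ℂ))⁻¹) x :=
    ContDiffAt.inv (by fun_prop) hx'
  unfold reducedField
  simp only [div_eq_mul_inv]
  refine ContDiffAt.prodMk ?_ (ContDiffAt.prodMk ?_ (ContDiffAt.prodMk ?_ (ContDiffAt.prodMk ?_
    (ContDiffAt.prodMk ?_ ?_)))) <;> fun_prop

theorem IsReducedSolution.eq {ν : ℝ} {X Y : ℝ → State} (hX : IsReducedSolution ν X)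
    (hY : IsReducedSolution ν Y) (h0 : X 0 = Y 0) {t : ℝ} (ht : 0 ≤ t) : X t = Y t := by
  exact eq_of_forward_solutions (v := reducedField ν) (Ω := {x : State | 0 < x.1})
    (fun x hx => (contDiffAt_reducedField ν (ne_of_gt hx)).of_le (by norm_cast)) hX hY h0 ht

end EightMode

/-! ### The change of variables -/

namespace EightMode

theorem hasDerivWithinAt_fst {E F : Type*} [NormedAddCommGroup E] [NormedSpace ℝ E]
    [NormedAddCommGroup F] [NormedSpace ℝ F] {f : ℝ → E × F} {f' : E × F} {s : Set ℝ} {t : ℝ}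
    (hf : HasDerivWithinAt f f' s t) : HasDerivWithinAt (fun τ => (f τ).1) f'.1 s t :=
  (ContinuousLinearMap.fst ℝ E F).hasFDerivAt.comp_hasDerivWithinAt t hf

theorem hasDerivWithinAt_snd {E F : Type*} [NormedAddCommGroup E] [NormedSpace ℝ E]
    [NormedAddCommGroup F] [NormedSpace ℝ F] {f : ℝ → E × F} {f' : E × F} {s : Set ℝ} {t : ℝ}
    (hf : HasDerivWithinAt f f' s t) : HasDerivWithinAt (fun τ => (f τ).2) f'.2 s t :=
  (ContinuousLinearMap.snd ℝ E F).hasFDerivAt.comp_hasDerivWithinAt t hf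

theorem hasDerivWithinAt_norm_sq {f : ℝ → ℂ} {f' : ℂ} {s : Set ℝ} {t : ℝ}
    (hf : HasDerivWithinAt f f' s t) :
    HasDerivWithinAt (fun τ => ‖f τ‖ ^ 2) (2 * (conj (f t) * f').re) s t := by
  have h := hf.norm_sq
  rwa [Complex.inner, mul_comm f'] at h

theorem hasDerivWithinAt_conj {f : ℝ → ℂ} {f' : ℂ} {s : Set ℝ} {t : ℝ}
    (hf : HasDerivWithinAt f f' s t) :
    HasDerivWithinAt (fun τ => conj (f τ)) (conj f') s t :=
  (Complex.conjCLE : ℂ →L[ℝ] ℂ).hasFDerivAt.comp_hasDerivWithinAt t hf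

theorem ofReal_norm_sq (z : ℂ) : (((‖z‖ ^ 2 : ℝ)) : ℂ) = z * conj z := by
  rw [Complex.mul_conj, Complex.normSq_eq_norm_sq]

theorem IsModeSolution.hasDerivWithinAt {ν : ℝ} {u : ℝ → Modes} (hu : IsModeSolution ν u) {t : ℝ}
    (ht : 0 ≤ t) :
    HasDerivWithinAt (fun s => (u s).1) (modeField ν (u t)).1 (Ici 0) t ∧
    HasDerivWithinAt (fun s => (u s).2.1) (modeField ν (u t)).2.1 (Ici 0) t ∧
    HasDerivWithinAt (fun s => (u s).2.2.1) (modeField ν (u t)).2.2.1 (Ici 0) t ∧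
    HasDerivWithinAt (fun s => (u s).2.2.2) (modeField ν (u t)).2.2.2 (Ici 0) t :=
  have h := hu t ht
  ⟨hasDerivWithinAt_fst h, hasDerivWithinAt_fst (hasDerivWithinAt_snd h),
    hasDerivWithinAt_fst (hasDerivWithinAt_snd (hasDerivWithinAt_snd h)),
    hasDerivWithinAt_snd (hasDerivWithinAt_snd (hasDerivWithinAt_snd h))⟩

theorem re_ofReal_eq (z : ℂ) : ((z.re : ℝ) : ℂ) = (z + conj z) / 2 := Complex.re_eq_add_conj z

/-- The change of variables carries nonvanishing solutions of the eight-mode model to solutions of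
the reduced system. -/
theorem IsModeSolution.isReducedSolution {ν : ℝ} (hν : ν ≠ 0) {u : ℝ → Modes}
    (hu : IsModeSolution ν u) (h0 : ∀ t, 0 ≤ t → (u t).1 ≠ 0 ∧ (u t).2.1 ≠ 0) :
    IsReducedSolution ν (fun t => changeVars (u t)) := by
  intro t ht
  obtain ⟨d1, d3, d5, d7⟩ := hu.hasDerivWithinAt ht
  obtain ⟨n1, n3⟩ := h0 t ht
  have hν' : (ν : ℂ) ≠ 0 := by exact_mod_cast hν
  have hN3 : ‖(u t).2.1‖ ^ 2 ≠ 0 := by positivity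
  have c3 : conj (u t).2.1 ≠ 0 := by simpa using n3
  have c1 : conj (u t).1 ≠ 0 := by simpa using n1
  have hP : HasDerivWithinAt (fun s => (u s).1 * conj (u s).2.1 * conj (u s).2.2.2 /
      ((‖(u s).2.1‖ ^ 2 : ℝ) : ℂ)) _ (Ici 0) t :=
    ((d1.mul (hasDerivWithinAt_conj d3)).mul (hasDerivWithinAt_conj d7)).div
      (hasDerivWithinAt_norm_sq d3).ofReal_comp (by exact_mod_cast hN3)
  have hQ : HasDerivWithinAt (fun s => conj (u s).1 * conj (u s).2.1 * (u s).2.2.1 /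
      ((‖(u s).2.1‖ ^ 2 : ℝ) : ℂ)) _ (Ici 0) t :=
    (((hasDerivWithinAt_conj d1).mul (hasDerivWithinAt_conj d3)).mul d5).div
      (hasDerivWithinAt_norm_sq d3).ofReal_comp (by exact_mod_cast hN3)
  have hall := ((hasDerivWithinAt_norm_sq d1).div (hasDerivWithinAt_norm_sq d3) hN3).prodMk
    (((hasDerivWithinAt_norm_sq d1).add (hasDerivWithinAt_norm_sq d3)).prodMk
      ((hasDerivWithinAt_norm_sq d5).prodMk ((hasDerivWithinAt_norm_sq d7).prodMk
        (hP.prodMk hQ))))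
  refine ⟨?_, hall.congr_deriv ?_⟩
  · have : 0 < ‖(u t).1‖ := norm_pos_iff.2 n1
    have : 0 < ‖(u t).2.1‖ := norm_pos_iff.2 n3
    simp only [changeVars]
    positivity
  · clear hall hP hQ d1 d3 d5 d7 h0 hu
    simp only [changeVars, modeField, reducedField, Pi.mul_apply]
    generalize (u t).1 = a at *
    generalize (u t).2.1 = b at *
    generalize (u t).2.2.1 = c at *
    generalize (u t).2.2.2 = d at *
    refine Prod.ext ?_ (Prod.ext ?_ (Prod.ext ?_ (Prod.ext ?_ (Prod.ext ?_ ?_))))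
    -- With |ω|² written as ω times its conjugate and the conjugates treated as independent symbols,
    -- each component is an identity of rational functions.
    all_goals
      simp only [pow_two (‖b‖ ^ 2), pow_two ((‖b‖ ^ 2 : ℝ) : ℂ)]
      try apply Complex.ofReal_injective
      simp only [Complex.ofReal_sub, Complex.ofReal_add, Complex.ofReal_mul, Complex.ofReal_div,
        Complex.ofReal_neg, Complex.ofReal_one, Complex.ofReal_ofNat,
        re_ofReal_eq, ofReal_norm_sq, map_div₀, map_add, map_sub, map_mul,
        map_neg, map_one, map_ofNat, Complex.conj_conj, Complex.conj_ofReal]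
      generalize conj a = a' at *
      generalize conj b = b' at *
      generalize conj c = c' at *
      generalize conj d = d' at *
      field_simp
      ring

end EightMode

/-! ### Weighted scaling and the rescaled system -/

namespace EightMode

/-- The weighted scaling of `(A, w, z, P, Q)` with weights `(1, 2, 2, 1, 1)`. -/
noncomputable def transverseScaling (μ : ℝ) : Transverse →L[ℝ] Transverse :=
  (μ • ContinuousLinearMap.id ℝ ℝ).prodMap
    ((μ ^ 2 • ContinuousLinearMap.id ℝ ℝ).prodMap
      ((μ ^ 2 • ContinuousLinearMap.id ℝ ℝ).prodMap
        ((μ • ContinuousLinearMap.id ℝ ℂ).prodMap (μ • ContinuousLinearMap.id ℝ ℂ))))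

theorem transverseScaling_apply (μ : ℝ) (y : Transverse) : transverseScaling μ y =
    (μ * y.1, μ ^ 2 * y.2.1, μ ^ 2 * y.2.2.1, μ • y.2.2.2.1, μ • y.2.2.2.2) :=
  rfl

theorem transverseScaling_mul (μ l : ℝ) (y : Transverse) :
    transverseScaling (μ * l) y = transverseScaling μ (transverseScaling l y) := by
  simp only [transverseScaling_apply, mul_smul, mul_pow, mul_assoc]

theorem norm_transverseScaling_le {μ : ℝ} (h0 : 0 ≤ μ) (h1 : μ ≤ 1) (y : Transverse) :
    ‖transverseScaling μ y‖ ≤ μ * ‖y‖ := by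
  have hsq : μ ^ 2 ≤ μ := by nlinarith
  have hy1 : ‖y.1‖ ≤ ‖y‖ := norm_fst_le y
  have hy2 : ‖y.2‖ ≤ ‖y‖ := norm_snd_le y
  have hy3 := (norm_fst_le y.2).trans hy2
  have hy4 := (norm_snd_le y.2).trans hy2
  have hy5 := (norm_fst_le y.2.2).trans hy4
  have hy6 := (norm_snd_le y.2.2).trans hy4
  have hy7 := (norm_fst_le y.2.2.2).trans hy6
  have hy8 := (norm_snd_le y.2.2.2).trans hy6
  rw [transverseScaling_apply]
  simp only [norm_prod_le_iff, norm_mul, norm_smul, norm_pow, Real.norm_of_nonneg h0]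
  refine ⟨?_, ?_, ?_, ?_, ?_⟩ <;> gcongr

/-- The weighted scaling of `(A, w, z, P, Q)`, leaving `R` fixed. -/
noncomputable def scaling (μ : ℝ) (x : State) : State := (x.1, transverseScaling μ x.2)

theorem scaling_one (x : State) : scaling 1 x = x := by
  simp [scaling, transverseScaling_apply]

/-- The rate `-λ'/λ` at which the scaling parameter decreases. -/
noncomputable def scalingRate (ν l : ℝ) (x : State) : ℝ := 2 * ν + l * x.2.1 / (5 * ν)

/-- The reduced system for the variables scaled by `λ`, with `λ` as the independent variable.
It is regular at `λ = 0`. -/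
noncomputable def rescaledField (ν l : ℝ) (x : State) : State :=
  (-((1 + x.1) * (x.2.2.2.2.1.re - x.2.2.2.2.2.re)) * (scalingRate ν l x)⁻¹,
    -(x.2.1 ^ 2 / (5 * ν) + 3 / (20 * ν) * (x.2.2.1 + x.2.2.2.1) * l * x.2.1) *
      (scalingRate ν l x)⁻¹,
    0, 0,
    -(scalingRate ν l x)⁻¹ • ((x.2.2.2.1 / 2 * (1 - x.1) : ℂ)
      + x.2.2.2.2.1 * (x.2.2.2.2.1.re - x.2.2.2.2.2.re : ℝ)
      + x.2.2.2.2.1 / 2 * (conj x.2.2.2.2.2 - x.2.2.2.2.2 / x.1)),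
    -(scalingRate ν l x)⁻¹ • ((x.2.2.1 / 2 * (x.1 - 1) : ℂ)
      + x.2.2.2.2.2 * (x.2.2.2.2.1.re - x.2.2.2.2.2.re : ℝ)
      + x.2.2.2.2.2 / 2 * (x.2.2.2.2.1 / x.1 - conj x.2.2.2.2.1)))

theorem contDiffAt_rescaledField {ν : ℝ} {p : ℝ × State} (h1 : p.2.1 ≠ 0)
    (h2 : scalingRate ν p.1 p.2 ≠ 0) :
    ContDiffAt ℝ ∞ (fun p : ℝ × State => ((1 : ℝ), rescaledField ν p.1 p.2)) p := by
  have h1' : ((p.2.1 : ℝ) : ℂ) ≠ 0 := by exact_mod_cast h1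
  have hinv : ContDiffAt ℝ ∞ (fun q : ℝ × State => ((q.2.1 : ℂ))⁻¹) p :=
    ContDiffAt.inv (by fun_prop) h1'
  have hrate : ContDiffAt ℝ ∞ (fun q : ℝ × State => (scalingRate ν q.1 q.2)⁻¹) p :=
    ContDiffAt.inv (by unfold scalingRate; fun_prop) h2
  refine contDiffAt_const.prodMk ?_
  unfold rescaledField
  refine ContDiffAt.prodMk ?_ (ContDiffAt.prodMk ?_ (ContDiffAt.prodMk ?_ (ContDiffAt.prodMk ?_
    (ContDiffAt.prodMk ?_ ?_)))) <;> try simp only [div_eq_mul_inv]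
  all_goals fun_prop

/-- The parameter `l` enters the field only through its product with the `A`-component, and all
terms have matching weights. The unit in which λ is measured is therefore immaterial; this symmetry
makes the flow a scaling in the chart. -/
theorem rescaledField_scaling (ν l μ : ℝ) (x : State) :
    rescaledField ν l (scaling μ x) = (μ * (rescaledField ν (μ * l) x).1,
      μ • transverseScaling μ (rescaledField ν (μ * l) x).2) := by
  have hr : scalingRate ν l (scaling μ x) = scalingRate ν (μ * l) x := by
    simp only [scalingRate, scaling, transverseScaling_apply]; ring
  simp only [rescaledField, hr]
  simp only [scaling, transverseScaling_apply, Prod.smul_mk, smul_eq_mul, Complex.real_smul,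
    Complex.re_ofReal_mul, Complex.ofReal_mul, Complex.ofReal_pow, Complex.ofReal_sub,
    Complex.ofReal_neg, Complex.ofReal_inv, map_mul, Complex.conj_ofReal]
  refine Prod.ext ?_ (Prod.ext ?_ (Prod.ext ?_ (Prod.ext ?_ (Prod.ext ?_ ?_)))) <;> simp only <;>
    ring

theorem hasDerivAt_scaling {y : ℝ → State} {v : State} {l : ℝ} (hy : HasDerivAt y v l) :
    HasDerivAt (fun l => scaling l (y l)) (v.1, transverseScaling l v.2 +
      ((y l).2.1, 2 * l * (y l).2.2.1, 2 * l * (y l).2.2.2.1, (y l).2.2.2.2)) l := by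
  rw [← hasDerivWithinAt_univ] at hy ⊢
  have hid := hasDerivWithinAt_id l univ
  have hsq : HasDerivWithinAt (fun l : ℝ => l ^ 2) (2 * l) univ l := by
    simpa using hasDerivAt_pow 2 l
  have h2 := hasDerivWithinAt_snd hy
  have h3 := hasDerivWithinAt_snd h2
  have h4 := hasDerivWithinAt_snd h3
  have h5 := hasDerivWithinAt_snd h4
  refine ((hasDerivWithinAt_fst hy).prodMk ((hid.mul (hasDerivWithinAt_fst h2)).prodMk
    ((hsq.mul (hasDerivWithinAt_fst h3)).prodMk ((hsq.mul (hasDerivWithinAt_fst h4)).prodMk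
      ((hid.smul (hasDerivWithinAt_fst h5)).prodMk
        (hid.smul (hasDerivWithinAt_snd h5))))))).congr_deriv ?_
  simp only [transverseScaling_apply, Prod.mk_add_mk, Prod.mk.injEq, id, one_mul, one_smul,
    true_and]
  refine ⟨?_, ?_, ?_, ?_⟩
  · ring
  · ring
  · ring
  · ext <;> simp

/-- Along a solution of the rescaled system, the original variables solve the reduced system if the
scaling parameter decreases at the rate `scalingRate`. -/
theorem hasDerivWithinAt_scaling {ν : ℝ} (hν : ν ≠ 0) {y : ℝ → State} {l : ℝ → ℝ} {s : Set ℝ}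
    {t : ℝ} (hR : (y (l t)).1 ≠ 0) (hg : scalingRate ν (l t) (y (l t)) ≠ 0)
    (hy : HasDerivAt y (rescaledField ν (l t) (y (l t))) (l t))
    (hl : HasDerivWithinAt l (-(l t * scalingRate ν (l t) (y (l t)))) s t) :
    HasDerivWithinAt (fun τ => scaling (l τ) (y (l τ)))
      (reducedField ν (scaling (l t) (y (l t)))) s t := by
  refine ((hasDerivAt_scaling hy).scomp_hasDerivWithinAt t hl).congr_deriv ?_
  generalize y (l t) = x at *
  generalize l t = m at *
  have hR' : (x.1 : ℂ) ≠ 0 := by exact_mod_cast hR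
  have hν' : (ν : ℂ) ≠ 0 := by exact_mod_cast hν
  obtain ⟨k, hk⟩ : ∃ k, k = scalingRate ν m x := ⟨_, rfl⟩
  have hk' : (k : ℂ) = 2 * ν + m * x.2.1 / (5 * ν) := by
    rw [hk, scalingRate]; push_cast; ring
  have hkr : k = 2 * ν + m * x.2.1 / (5 * ν) := hk
  have hk0 : k ≠ 0 := by rwa [hk]
  have hkc : (k : ℂ) ≠ 0 := by exact_mod_cast hk0
  simp only [rescaledField, ← hk]
  simp only [reducedField, scaling, transverseScaling_apply, Prod.smul_mk, smul_eq_mul,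
    Complex.real_smul, Complex.re_ofReal_mul, Complex.ofReal_mul, Complex.ofReal_pow,
    Complex.ofReal_sub, Complex.ofReal_neg, Complex.ofReal_inv, map_mul, Complex.conj_ofReal,
    Prod.mk_add_mk]
  clear hk hg hl hy
  refine Prod.ext ?_ (Prod.ext ?_ (Prod.ext ?_ (Prod.ext ?_ (Prod.ext ?_ ?_))))
  · field_simp
  · field_simp
    rw [hkr]
    field_simp
    ring
  · simp only; rw [hkr]; field_simp; ring
  · simp only; rw [hkr]; field_simp; ring
  all_goals
    generalize (x.2.2.2.2.1.re : ℂ) = p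
    generalize (x.2.2.2.2.2.re : ℂ) = q
    generalize conj x.2.2.2.2.1 = P'
    generalize conj x.2.2.2.2.2 = Q'
    simp only [Prod.fst_add, Prod.snd_add, Prod.smul_fst, Prod.smul_snd, Complex.real_smul, Complex.ofReal_neg,
      Complex.ofReal_mul, mul_add]
    field_simp
    rw [hk']
    field_simp
    ring

end EightMode

/-! ### The flow of the rescaled system from λ = 0 -/

namespace EightMode

theorem scaling_mul (μ l : ℝ) (x : State) : scaling (μ * l) x = scaling μ (scaling l x) :=
  Prod.ext rfl (transverseScaling_mul μ l x.2)

theorem scaling_fixedPoint (μ r : ℝ) : scaling μ (fixedPoint r) = fixedPoint r := by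
  simp [scaling, fixedPoint]

theorem scaling_mem_ball {μ r δ : ℝ} (h0 : 0 ≤ μ) (h1 : μ ≤ 1) {x : State}
    (hx : x ∈ Metric.ball (fixedPoint r) δ) : scaling μ x ∈ Metric.ball (fixedPoint r) δ := by
  rw [Metric.mem_ball, Prod.dist_eq, max_lt_iff] at hx ⊢
  refine ⟨hx.1, ?_⟩
  have h2 := hx.2
  simp only [fixedPoint, dist_zero_right] at h2 ⊢
  refine (norm_transverseScaling_le h0 h1 x.2).trans_lt (lt_of_le_of_lt ?_ h2)
  exact mul_le_of_le_one_left (norm_nonneg _) h1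

theorem rescaledField_fixedPoint (ν l r : ℝ) : rescaledField ν l (fixedPoint r) = 0 := by
  simp [rescaledField, fixedPoint]

/-- Neighbourhoods of `(0, fixedPoint r)` on which the rescaled system is regular. -/
theorem exists_regular_ball {ν r : ℝ} (hν : 0 < ν) (hr : 0 < r) :
    ∃ η > 0, ∃ K, LipschitzOnWith K (fun p : ℝ × State => ((1 : ℝ), rescaledField ν p.1 p.2))
      (Metric.ball ((0 : ℝ), fixedPoint r) η) ∧
      ∀ p ∈ Metric.ball ((0 : ℝ), fixedPoint r) η, 0 < p.2.1 ∧
        ν ≤ scalingRate ν p.1 p.2 ∧ scalingRate ν p.1 p.2 ≤ 3 * ν := by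
  have hcont : Continuous fun p : ℝ × State => scalingRate ν p.1 p.2 := by
    unfold scalingRate; fun_prop
  have hb : scalingRate ν ((0 : ℝ), fixedPoint r).1 ((0 : ℝ), fixedPoint r).2 = 2 * ν := by
    simp [scalingRate]
  obtain ⟨K, T, hT, hK⟩ := ((contDiffAt_rescaledField (ν := ν) (p := ((0 : ℝ), fixedPoint r))
    hr.ne' (by rw [hb]; positivity)).of_le (n := ∞) (m := 1) (by norm_cast)).exists_lipschitzOnWith
  have hev : ∀ᶠ p in 𝓝 ((0 : ℝ), fixedPoint r), p ∈ T ∧ 0 < p.2.1 ∧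
      ν < scalingRate ν p.1 p.2 ∧ scalingRate ν p.1 p.2 < 3 * ν := by
    refine (show ∀ᶠ p in 𝓝 ((0 : ℝ), fixedPoint r), p ∈ T from hT).and
      ((((continuous_fst.comp continuous_snd).continuousAt (x := ((0 : ℝ), fixedPoint r))).eventually_const_lt hr).and
      ((hcont.continuousAt.eventually_const_lt (by simp only [hb]; linarith)).and
        (hcont.continuousAt.eventually_lt_const (by simp only [hb]; linarith))))
  obtain ⟨η, hη, h⟩ := Metric.eventually_nhds_iff_ball.1 hev
  exact ⟨η, hη, K, hK.mono fun p hp => (h p hp).1, fun p hp =>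
    ⟨(h p hp).2.1, (h p hp).2.2.1.le, (h p hp).2.2.2.le⟩⟩

/-- The smooth local flow of the rescaled system, started at `λ = 0`. -/
theorem exists_rescaled_flow {ν r : ℝ} (hν : 0 < ν) (hr : 0 < r) :
    ∃ Φ : ℝ → State → State, ∃ ε > 0, ∃ δ > 0,
      ContDiffOn ℝ ∞ (fun p : ℝ × State => Φ p.1 p.2)
        (Ioo (-ε) ε ×ˢ Metric.ball (fixedPoint r) δ) ∧
      (∀ x ∈ Metric.ball (fixedPoint r) δ, Φ 0 x = x ∧ ∀ l ∈ Ioo (-ε) ε,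
        0 < (Φ l x).1 ∧ ν ≤ scalingRate ν l (Φ l x) ∧ scalingRate ν l (Φ l x) ≤ 3 * ν ∧
        HasDerivAt (fun s => Φ s x) (rescaledField ν l (Φ l x)) l) ∧
      (∀ x ∈ Metric.ball (fixedPoint r) δ, ∀ μ ∈ Ioc (0 : ℝ) 1, ∀ l ∈ Ico 0 ε,
        Φ l (scaling μ x) = scaling μ (Φ (μ * l) x)) ∧
      ∀ r' : ℝ, fixedPoint r' ∈ Metric.ball (fixedPoint r) δ → ∀ l ∈ Ico 0 ε,
        Φ l (fixedPoint r') = fixedPoint r' := by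
  obtain ⟨η, hη, K, hK, hreg⟩ := exists_regular_ball hν hr
  -- The system is made autonomous by adjoining λ as a coordinate of speed 1.
  obtain ⟨φ, ε, hε, δ, hδ, hφs, hφ⟩ := exists_local_flow
    (G := fun p : ℝ × State => ((1 : ℝ), rescaledField ν p.1 p.2))
    (Metric.isOpen_ball (x := ((0 : ℝ), fixedPoint r)) (ε := η))
    (fun p hp => (contDiffAt_rescaledField (hreg p hp).1.ne'
      (hν.trans_le (hreg p hp).2.1).ne').contDiffWithinAt) (Metric.mem_ball_self hη)
  have hin : ∀ x ∈ Metric.ball (fixedPoint r) (min δ η),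
      ((0 : ℝ), x) ∈ Metric.ball ((0 : ℝ), fixedPoint r) δ := by
    intro x hx
    rw [Metric.mem_ball, Prod.dist_eq]
    simpa [hδ] using (Metric.ball_subset_ball (min_le_left _ _) hx)
  -- the first component of the flow is the independent variable
  have hfst : ∀ x ∈ Metric.ball (fixedPoint r) (min δ η), ∀ l ∈ Ioo (-ε) ε, (φ l (0, x)).1 = l := by
    intro x hx l hl
    have hd : ∀ s ∈ Ioo (-ε) ε, HasDerivWithinAt (fun s => (φ s (0, x)).1 - s) 0 (Ioo (-ε) ε) s := by
      intro s hs
      have h1 := hasDerivWithinAt_fst (((hφ _ (hin x hx)).2 s hs).2.hasDerivWithinAt (s := Ioo (-ε) ε))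
      exact (h1.sub (hasDerivWithinAt_id s _)).congr_deriv (sub_self 1)
    have h0 : (0 : ℝ) ∈ Ioo (-ε) ε := ⟨by linarith, hε⟩
    have h2 := (convex_Ioo (-ε) ε).is_const_of_fderivWithin_eq_zero (𝕜 := ℝ)
      (f := fun s => (φ s (0, x)).1 - s) (fun s hs => (hd s hs).differentiableWithinAt)
      (fun s hs => by
        have h3 := (hd s hs).hasFDerivWithinAt.fderivWithin (isOpen_Ioo.uniqueDiffWithinAt hs)
        rw [h3]; ext; simp) hl h0
    simp only [(hφ _ (hin x hx)).1] at h2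
    linarith
  have hΦd : ∀ x ∈ Metric.ball (fixedPoint r) (min δ η), ∀ l ∈ Ioo (-ε) ε,
      ((l, (φ l (0, x)).2) : ℝ × State) ∈ Metric.ball ((0 : ℝ), fixedPoint r) η ∧
      HasDerivAt (fun s => (φ s (0, x)).2) (rescaledField ν l (φ l (0, x)).2) l := by
    intro x hx l hl
    obtain ⟨h1, h2⟩ := (hφ _ (hin x hx)).2 l hl
    have h3 : φ l (0, x) = (l, (φ l (0, x)).2) := Prod.ext (hfst x hx l hl) rfl
    refine ⟨by rwa [← h3], ?_⟩
    have h4 := hasDerivWithinAt_snd (h2.hasDerivWithinAt (s := univ))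
    rw [hasDerivWithinAt_univ] at h4
    refine h4.congr_deriv ?_
    simp only [hfst x hx l hl]
  -- uniqueness for solutions staying near the fixed point
  have huniq : ∀ l ∈ Ico 0 ε, ∀ Y Z : ℝ → State,
      (∀ s ∈ Icc 0 l, ((s, Y s) : ℝ × State) ∈ Metric.ball ((0 : ℝ), fixedPoint r) η ∧
        HasDerivAt Y (rescaledField ν s (Y s)) s) →
      (∀ s ∈ Icc 0 l, ((s, Z s) : ℝ × State) ∈ Metric.ball ((0 : ℝ), fixedPoint r) η ∧
        HasDerivAt Z (rescaledField ν s (Z s)) s) → Y 0 = Z 0 → Y l = Z l := by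
    intro l hl Y Z hY hZ h0
    refine ODE_solution_unique_of_mem_Icc_right (v := rescaledField ν) (K := K)
      (s := fun s => {x | ((s, x) : ℝ × State) ∈ Metric.ball ((0 : ℝ), fixedPoint r) η})
      (fun s _ x hx y hy => ?_)
      (fun s hs => (hY s hs).2.continuousAt.continuousWithinAt)
      (fun s hs => (hY s (Ico_subset_Icc_self hs)).2.hasDerivWithinAt)
      (fun s hs => (hY s (Ico_subset_Icc_self hs)).1)
      (fun s hs => (hZ s hs).2.continuousAt.continuousWithinAt)
      (fun s hs => (hZ s (Ico_subset_Icc_self hs)).2.hasDerivWithinAt)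
      (fun s hs => (hZ s (Ico_subset_Icc_self hs)).1) h0 (right_mem_Icc.2 hl.1)
    have h1 := hK hx hy
    simpa [Prod.edist_eq] using h1
  refine ⟨fun l x => (φ l (0, x)).2, ε, hε, min δ η, lt_min hδ hη, ?_, fun x hx =>
    ⟨by simp only [(hφ _ (hin x hx)).1], fun l hl => ?_⟩, fun x hx μ hμ l hl => ?_,
    fun r' hr' l hl => ?_⟩
  · refine contDiff_snd.comp_contDiffOn (hφs.comp
      (f := fun p : ℝ × State => (p.1, ((0 : ℝ), p.2))) ?_ fun p hp => ⟨hp.1, hin _ hp.2⟩)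
    exact (contDiff_fst.prodMk (contDiff_const.prodMk contDiff_snd)).contDiffOn
  · obtain ⟨h1, h2⟩ := hΦd x hx l hl
    exact ⟨(hreg _ h1).1, (hreg _ h1).2.1, (hreg _ h1).2.2, h2⟩
  · have hsx := scaling_mem_ball hμ.1.le hμ.2 hx
    -- Both sides solve the rescaled system with initial value `scaling μ x`. The condition μ ≤ 1
    -- keeps μs inside the interval of existence.
    refine huniq l hl _ (fun s => scaling μ (φ (μ * s) (0, x)).2)
      (fun s hs => hΦd _ hsx s ⟨by linarith [hs.1], hs.2.trans_lt hl.2⟩) (fun s hs => ?_) ?_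
    · have hμs : μ * s ∈ Ioo (-ε) ε := by
        have h0 : 0 ≤ μ * s := mul_nonneg hμ.1.le hs.1
        have h1 : μ * s ≤ s := mul_le_of_le_one_left hs.1 hμ.2
        exact ⟨by linarith, by linarith [hs.2, hl.2]⟩
      obtain ⟨h1, h2⟩ := hΦd x hx (μ * s) hμs
      refine ⟨?_, ?_⟩
      · rw [Metric.mem_ball, Prod.dist_eq, max_lt_iff] at h1 ⊢
        refine ⟨?_, scaling_mem_ball hμ.1.le hμ.2 h1.2⟩
        have h3 := (hΦd _ hsx s ⟨by linarith [hs.1], hs.2.trans_lt hl.2⟩).1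
        rw [Metric.mem_ball, Prod.dist_eq, max_lt_iff] at h3
        exact h3.1
      · have h3 : HasDerivAt (fun s => φ (μ * s) (0, x) |>.2)
            (μ • rescaledField ν (μ * s) (φ (μ * s) (0, x)).2) s :=
          h2.scomp s (by simpa using (hasDerivAt_id s).const_mul μ)
        have h4 : HasDerivAt (fun s => scaling μ (φ (μ * s) (0, x)).2) _ s :=
          (((ContinuousLinearMap.id ℝ ℝ).prodMap
            (transverseScaling μ)).hasFDerivAt.comp_hasDerivAt s h3)
        refine h4.congr_deriv ?_
        rw [rescaledField_scaling, map_smul]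
        rfl
    · simp only [mul_zero, (hφ _ (hin _ hsx)).1, (hφ _ (hin _ hx)).1]
  · refine huniq l hl _ (fun _ => fixedPoint r')
      (fun s hs => hΦd _ hr' s ⟨by linarith [hs.1], hs.2.trans_lt hl.2⟩) (fun s hs => ?_) ?_
    · refine ⟨?_, ?_⟩
      · have h3 := (hΦd _ hr' s ⟨by linarith [hs.1], hs.2.trans_lt hl.2⟩).1
        rw [Metric.mem_ball, Prod.dist_eq, max_lt_iff] at h3 ⊢
        exact ⟨h3.1, Metric.ball_subset_ball (min_le_right _ _) hr'⟩
      · rw [rescaledField_fixedPoint]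
        exact hasDerivAt_const _ _
    · rw [(hφ _ (hin _ hr')).1]

end EightMode

/-! ### The linearizing chart -/

namespace EightMode

/-- For `l ≠ 0` the weighted scaling is invertible. -/
noncomputable def transverseScalingEquiv {l : ℝ} (hl : l ≠ 0) : Transverse ≃L[ℝ] Transverse :=
  ContinuousLinearEquiv.equivOfInverse (transverseScaling l) (transverseScaling l⁻¹)
    (fun y => by rw [← transverseScaling_mul, inv_mul_cancel₀ hl]; simp [transverseScaling_apply])
    (fun y => by rw [← transverseScaling_mul, mul_inv_cancel₀ hl]; simp [transverseScaling_apply])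

/-- Trajectories of the reduced system obtained from the rescaled flow. -/
theorem exists_reducedSolution_of_rescaled {ν : ℝ} (hν : 0 < ν) {y : ℝ → State} {l₀ : ℝ}
    (hl₀ : 0 < l₀)
    (hy : ∀ l ∈ Ioc 0 l₀, 0 < (y l).1 ∧ ν ≤ scalingRate ν l (y l) ∧
      scalingRate ν l (y l) ≤ 3 * ν ∧ HasDerivAt y (rescaledField ν l (y l)) l) :
    ∃ μ : ℝ → ℝ, μ 0 = 1 ∧ (∀ t, 0 ≤ t → 0 < μ t ∧ μ t ≤ Real.exp (-ν * t)) ∧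
      IsReducedSolution ν (fun t => scaling (μ t * l₀) (y (μ t * l₀))) := by
  -- The unknown is L = -log(λ / l₀), whose derivative is `scalingRate`, pinched between ν and 3ν.
  -- The maximum with 0 keeps λ in `(0, l₀]` for every argument and is inactive for t ≥ 0, where L ≥
  -- 0.
  set m : ℝ → ℝ := fun L => Real.exp (-(max L 0)) * l₀ with hm
  have hmem : ∀ L, m L ∈ Ioc 0 l₀ := fun L =>
    ⟨by positivity, mul_le_of_le_one_left hl₀.le (by simp)⟩
  have hmc : Continuous m := by fun_prop
  have hcont : Continuous fun L => scalingRate ν (m L) (y (m L)) := by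
    have h1 : Continuous fun L => y (m L) := continuous_iff_continuousAt.2 fun L =>
      ContinuousAt.comp (f := m) (g := y) (hy _ (hmem L)).2.2.2.continuousAt hmc.continuousAt
    have h2 : Continuous fun L => (y (m L)).2.1 := continuous_fst.comp (continuous_snd.comp h1)
    unfold scalingRate
    fun_prop
  obtain ⟨L, hL0, hLd, hLge⟩ := exists_hasDerivAt_of_pinched hcont hν
    (fun x => (hy _ (hmem x)).2.1) (fun x => (hy _ (hmem x)).2.2.1)
  have hLm : ∀ t, 0 ≤ t → Real.exp (-(L t)) * l₀ = m (L t) := fun t ht => by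
    rw [hm]
    simp only
    rw [max_eq_left ((mul_nonneg hν.le ht).trans (hLge t ht))]
  refine ⟨fun t => Real.exp (-(L t)), by simp [hL0], fun t ht => ⟨Real.exp_pos _, ?_⟩,
    fun t ht => ?_⟩
  · have := hLge t ht
    exact Real.exp_le_exp.2 (by linarith)
  · have h1 := hy _ (hmem (L t))
    rw [← hLm t ht] at h1
    refine ⟨h1.1, ?_⟩
    refine hasDerivWithinAt_scaling hν.ne' (l := fun t => Real.exp (-(L t)) * l₀) h1.1.ne'
      (hν.trans_le h1.2.1).ne' h1.2.2.2 ?_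
    have h2 := ((hLd t).neg.exp.mul_const l₀).hasDerivWithinAt (s := Ici 0)
    refine h2.congr_deriv ?_
    rw [← hLm t ht, Pi.neg_apply]
    ring

/-- A chart near the fixed point in which the reduced flow is a weighted scaling. -/
theorem exists_chart {ν r : ℝ} (hν : 0 < ν) (hr : 0 < r) :
    ∃ S : State → State, ∃ δ > 0, ∃ K > 0, δ ≤ r ∧
      ContDiffOn ℝ ∞ S (Metric.ball (fixedPoint r) δ) ∧
      IsOpen (S '' Metric.ball (fixedPoint r) δ) ∧
      (∃ e : OpenPartialHomeomorph Transverse Transverse, e.source = Metric.ball 0 δ ∧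
        (∀ a, e a = (S (r, a)).2) ∧ ContDiffOn ℝ ∞ e.symm e.target) ∧
      (∀ x ∈ Metric.ball (fixedPoint r) δ, ∀ y ∈ Metric.ball (fixedPoint r) δ,
        ‖S x - S y‖ ≤ K * ‖x - y‖) ∧
      (∀ a ∈ Metric.ball (0 : Transverse) δ, ‖a‖ ≤ K * ‖(S (r, a)).2‖) ∧
      (∀ r' : ℝ, fixedPoint r' ∈ Metric.ball (fixedPoint r) δ → S (fixedPoint r') = fixedPoint r') ∧
      ∀ x ∈ Metric.ball (fixedPoint r) δ, ∃ μ : ℝ → ℝ, μ 0 = 1 ∧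
        (∀ t, 0 ≤ t → 0 < μ t ∧ μ t ≤ Real.exp (-ν * t)) ∧
        ∃ X : ℝ → State, IsReducedSolution ν X ∧ ∀ t, 0 ≤ t → X t = S (scaling (μ t) x) := by
  obtain ⟨Φ, ε, hε, δ, hδ, hΦs, hΦ, hΦscale, hΦfix⟩ := exists_rescaled_flow hν hr
  set p := fixedPoint r with hp
  have hpδ : p ∈ Metric.ball p δ := Metric.mem_ball_self hδ
  have hopen : IsOpen (Ioo (-ε) ε ×ˢ Metric.ball p δ) := isOpen_Ioo.prod Metric.isOpen_ball
  have hmem : ∀ l ∈ Ioo (-ε) ε, (l, p) ∈ Ioo (-ε) ε ×ˢ Metric.ball p δ := fun l hl => ⟨hl, hpδ⟩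
  have h0 : (0 : ℝ) ∈ Ioo (-ε) ε := ⟨by linarith, hε⟩
  -- the partial derivative of the flow with respect to the initial condition
  set L : ℝ → State →L[ℝ] State := fun l =>
    (fderiv ℝ (fun p : ℝ × State => Φ p.1 p.2) (l, p)).comp (ContinuousLinearMap.inr ℝ ℝ State) with hL
  have hLd : ∀ l ∈ Ioo (-ε) ε, HasFDerivAt (Φ l) (L l) p := by
    intro l hl
    have h1 : HasFDerivAt (fun p : ℝ × State => Φ p.1 p.2) _ (l, p) :=
      ((hΦs.contDiffAt (hopen.mem_nhds (hmem l hl))).differentiableAt (by simp)).hasFDerivAt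
    exact h1.comp p (hasFDerivAt_prodMk_right l p)
  have hLc : ContinuousAt L 0 := by
    have h1 := (hΦs.continuousOn_fderiv_of_isOpen hopen (by simp)).continuousAt
      (hopen.mem_nhds (hmem 0 h0))
    have h2 : ContinuousAt (fun l : ℝ => fderiv ℝ (fun p : ℝ × State => Φ p.1 p.2) (l, p)) 0 :=
      ContinuousAt.comp (f := fun l : ℝ => (l, p)) h1 (by fun_prop)
    exact h2.clm_comp continuousAt_const
  have hL0 : L 0 = ContinuousLinearMap.id ℝ State := by
    refine (hLd 0 h0).unique ((hasFDerivAt_id p).congr_of_eventuallyEq ?_)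
    filter_upwards [Metric.isOpen_ball.mem_nhds hpδ] with x hx using (hΦ x hx).1
  set B : ℝ → Transverse →L[ℝ] Transverse := fun l =>
    (ContinuousLinearMap.snd ℝ ℝ Transverse).comp
      ((L l).comp (ContinuousLinearMap.inr ℝ ℝ Transverse)) with hB
  have hBc : ContinuousAt B 0 := continuousAt_const.clm_comp (hLc.clm_comp continuousAt_const)
  have hB0 : B 0 = ContinuousLinearMap.id ℝ Transverse := by
    rw [hB]; simp only [hL0]; rfl
  -- At λ = 0 the flow is the identity. Invertibility is an open condition, so the derivative and
  -- its transverse block remain invertible for small λ.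
  have hev1 : ∀ᶠ l in 𝓝 (0 : ℝ), L l ∈ range ((↑) : (State ≃L[ℝ] State) → State →L[ℝ] State) :=
    hLc.eventually_mem (ContinuousLinearEquiv.isOpen.mem_nhds
      ⟨ContinuousLinearEquiv.refl ℝ State, by rw [hL0]; rfl⟩)
  have hev2 : ∀ᶠ l in 𝓝 (0 : ℝ),
      B l ∈ range ((↑) : (Transverse ≃L[ℝ] Transverse) → Transverse →L[ℝ] Transverse) :=
    hBc.eventually_mem (ContinuousLinearEquiv.isOpen.mem_nhds
      ⟨ContinuousLinearEquiv.refl ℝ Transverse, by rw [hB0]; rfl⟩)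
  obtain ⟨l₀, ⟨⟨⟨L', hL'⟩, ⟨B', hB'⟩⟩, hlε⟩, hl0⟩ :=
    (((hev1.and hev2).and (isOpen_Ioo.mem_nhds h0)).filter_mono nhdsWithin_le_nhds |>.and
      (self_mem_nhdsWithin (s := Ioi (0 : ℝ)))).exists
  replace hl0 : 0 < l₀ := hl0
  have hl0' : l₀ ∈ Ico 0 ε := ⟨hl0.le, hlε.2⟩
  -- The point `x` is the state at λ = 0, so `x.1` is the limiting value of `R`. It is carried to λ
  -- = l₀ and returned to the original variables; `l₀ > 0` is needed for this last scaling to be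
  -- invertible.
  set S : State → State := fun x => scaling l₀ (Φ l₀ x) with hS
  have hSs : ContDiffOn ℝ ∞ S (Metric.ball p δ) := by
    have h1 : ContDiffOn ℝ ∞ (Φ l₀) (Metric.ball p δ) :=
      hΦs.comp (f := fun x : State => (l₀, x)) (by fun_prop) fun x hx => ⟨hlε, hx⟩
    exact ((ContinuousLinearMap.id ℝ ℝ).prodMap (transverseScaling l₀)).contDiff.comp_contDiffOn h1
  have hSd : HasFDerivAt S ((L'.trans ((ContinuousLinearEquiv.refl ℝ ℝ).prodCongr
      (transverseScalingEquiv hl0.ne')) : State ≃L[ℝ] State) : State →L[ℝ] State) p := by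
    have h1 := ((ContinuousLinearMap.id ℝ ℝ).prodMap (transverseScaling l₀)).hasFDerivAt.comp p
      (hLd l₀ hlε)
    refine h1.congr_fderiv ?_
    rw [← hL']
    rfl
  have hTd : HasFDerivAt (fun a => (S (r, a)).2)
      ((B'.trans (transverseScalingEquiv hl0.ne') : Transverse ≃L[ℝ] Transverse) :
        Transverse →L[ℝ] Transverse) 0 := by
    have h1 := (transverseScaling l₀).hasFDerivAt.comp (0 : Transverse)
      ((ContinuousLinearMap.snd ℝ ℝ Transverse).hasFDerivAt.comp (0 : Transverse)
        ((hLd l₀ hlε).comp (0 : Transverse) (hasFDerivAt_prodMk_right r (0 : Transverse))))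
    refine h1.congr_fderiv ?_
    refine ContinuousLinearMap.ext fun a => ?_
    have h2 : (B' : Transverse →L[ℝ] Transverse) a = B l₀ a := by rw [hB']
    change _ = transverseScaling l₀ ((B' : Transverse →L[ℝ] Transverse) a)
    rw [h2]
    rfl
  have hball : ∀ {d : ℝ} {a : Transverse}, a ∈ Metric.ball (0 : Transverse) d →
      ((r, a) : State) ∈ Metric.ball p d := by
    intro d a ha
    rw [Metric.mem_ball, Prod.dist_eq, hp, fixedPoint]
    simp only [dist_self]
    rw [max_eq_right dist_nonneg]
    exact ha
  have hTs : ContDiffOn ℝ ∞ (fun a : Transverse => (S (r, a)).2) (Metric.ball 0 δ) :=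
    contDiff_snd.comp_contDiffOn (hSs.comp (f := fun a : Transverse => ((r, a) : State))
      (by fun_prop) fun a ha => hball ha)
  -- Two local inverses are needed: that of `S`, so that the image of a ball is open, and that of
  -- its transverse part on the slice over `r`, so that the image of the slice is a graph.
  obtain ⟨e, hpe, -, hee, -⟩ := exists_openPartialHomeomorph_contDiffOn_symm Metric.isOpen_ball
    hSs hpδ _ hSd
  obtain ⟨e₁, h0e, -, hee₁, he₁s⟩ := exists_openPartialHomeomorph_contDiffOn_symm
    Metric.isOpen_ball hTs (Metric.mem_ball_self hδ) _ hTd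
  have hSfix : ∀ r' : ℝ, fixedPoint r' ∈ Metric.ball p δ → S (fixedPoint r') = fixedPoint r' := by
    intro r' hr'
    rw [hS]
    simp only [hΦfix r' hr' l₀ hl0', scaling_fixedPoint]
  have he₁0 : e₁ 0 = 0 := by
    rw [hee₁]
    have := hSfix r hpδ
    rw [fixedPoint] at this
    rw [this]
  have h0t : (0 : Transverse) ∈ e₁.target := by
    have := e₁.map_source h0e
    rwa [he₁0] at this
  obtain ⟨K₁, T₁, hT₁, hK₁⟩ := ((hSs.contDiffAt (Metric.isOpen_ball.mem_nhds hpδ)).of_le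
    (m := 1) (by norm_cast)).exists_lipschitzOnWith
  obtain ⟨K₂, T₂, hT₂, hK₂⟩ := ((he₁s.contDiffAt (e₁.open_target.mem_nhds h0t)).of_le
    (m := 1) (by norm_cast)).exists_lipschitzOnWith
  have hev3 : ∀ᶠ x in 𝓝 p, x ∈ e.source ∧ x ∈ T₁ :=
    (show ∀ᶠ x in 𝓝 p, x ∈ e.source from e.open_source.mem_nhds hpe).and hT₁
  have hev4 : ∀ᶠ a in 𝓝 (0 : Transverse), a ∈ e₁.source ∧ e₁ a ∈ T₂ := by
    refine (show ∀ᶠ x in 𝓝 0, x ∈ e₁.source from e₁.open_source.mem_nhds h0e).and ?_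
    exact (e₁.continuousAt h0e).eventually_mem (by rwa [he₁0])
  obtain ⟨δ₁, hδ₁, hb₁⟩ := Metric.eventually_nhds_iff_ball.1 hev3
  obtain ⟨δ₂, hδ₂, hb₂⟩ := Metric.eventually_nhds_iff_ball.1 hev4
  set d := min (min δ₁ δ₂) (min δ r) with hd
  have hdpos : 0 < d := lt_min (lt_min hδ₁ hδ₂) (lt_min hδ hr)
  have hd1 : d ≤ δ₁ := (min_le_left _ _).trans (min_le_left _ _)
  have hd2 : d ≤ δ₂ := (min_le_left _ _).trans (min_le_right _ _)
  have hd3 : d ≤ δ := (min_le_right _ _).trans (min_le_left _ _)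
  have hd4 : d ≤ r := (min_le_right _ _).trans (min_le_right _ _)
  refine ⟨S, d, hdpos, K₁ + K₂ + 1, by positivity, hd4, hSs.mono (Metric.ball_subset_ball hd3),
    ?_, ⟨e₁.restrOpen _ (Metric.isOpen_ball (x := 0) (ε := d)), ?_, ?_, ?_⟩, ?_, ?_,
    fun r' hr' => hSfix r' (Metric.ball_subset_ball hd3 hr'), ?_⟩
  · have h1 := e.isOpen_image_of_subset_source Metric.isOpen_ball
      (fun x hx => (hb₁ x (Metric.ball_subset_ball hd1 hx)).1)
    have h2 : (e : State → State) = S := funext hee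
    rwa [h2] at h1
  · rw [OpenPartialHomeomorph.restrOpen_source]
    exact inter_eq_right.2 fun a ha => (hb₂ a (Metric.ball_subset_ball hd2 ha)).1
  · exact hee₁
  · refine ContDiffOn.mono (s := e₁.target) he₁s ?_
    intro y hy
    exact hy.1
  · intro x hx y hy
    have h1 := hK₁.norm_sub_le (hb₁ x (Metric.ball_subset_ball hd1 hx)).2
      (hb₁ y (Metric.ball_subset_ball hd1 hy)).2
    refine h1.trans ?_
    gcongr
    have := K₂.2
    linarith [K₂.coe_nonneg]
  · intro a ha
    obtain ⟨h1, h2⟩ := hb₂ a (Metric.ball_subset_ball hd2 ha)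
    have h3 := hK₂.norm_sub_le h2 (mem_of_mem_nhds hT₂)
    have h4 : e₁.symm 0 = 0 := by
      have h5 := e₁.left_inv h0e
      rwa [he₁0] at h5
    rw [e₁.left_inv h1, h4, sub_zero, sub_zero, hee₁] at h3
    refine h3.trans ?_
    gcongr
    linarith [K₁.coe_nonneg]
  · intro x hx
    have hxδ := Metric.ball_subset_ball hd3 hx
    obtain ⟨μ, hμ0, hμ, hX⟩ := exists_reducedSolution_of_rescaled hν (y := fun l => Φ l x) hl0
      (fun l hl => (hΦ x hxδ).2 l ⟨by linarith [hl.1], hl.2.trans_lt hlε.2⟩)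
    refine ⟨μ, hμ0, hμ, _, hX, fun t ht => ?_⟩
    have hμ1 : μ t ≤ 1 := (hμ t ht).2.trans (Real.exp_le_one_iff.2 (by nlinarith))
    simp only [hS]
    -- The scaling symmetry gives S(μ·x) = (μl₀)·Φ(μl₀, x), the point reached when λ = μl₀.
    rw [hΦscale x hxδ (μ t) ⟨(hμ t ht).1, hμ1⟩ l₀ hl0', ← scaling_mul, mul_comm l₀]

end EightMode

/-! ### The invariance equation through degree two -/

/-- A continuous function that is positively homogeneous of degree `k` on a finite-dimensional
space is bounded by a multiple of `‖y‖ ^ k`. -/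
theorem exists_bound_of_homogeneous {E : Type*} [NormedAddCommGroup E] [NormedSpace ℝ E]
    [FiniteDimensional ℝ E] {f : E → ℝ} (hf : Continuous f) (k : ℕ)
    (hk : ∀ (s : ℝ) y, f (s • y) = s ^ k * f y) : ∃ C, 0 ≤ C ∧ ∀ y, |f y| ≤ C * ‖y‖ ^ k := by
  obtain ⟨C, hC⟩ := (isCompact_closedBall (0 : E) 1).exists_bound_of_continuousOn hf.continuousOn
  have hC0 : 0 ≤ C := (norm_nonneg _).trans (hC 0 (by simp))
  refine ⟨C, hC0, fun y => ?_⟩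
  rcases eq_or_ne y 0 with rfl | hy
  · rcases Nat.eq_zero_or_pos k with rfl | hk0
    · simpa using hC 0 (by simp)
    · have := hk 0 0
      rw [smul_zero, zero_pow hk0.ne', zero_mul] at this
      rw [this]
      simp [hk0.ne']
  · have hn : ‖y‖ ≠ 0 := norm_ne_zero_iff.2 hy
    have h1 := hk ‖y‖ (‖y‖⁻¹ • y)
    rw [smul_smul, mul_inv_cancel₀ hn, one_smul] at h1
    rw [h1, abs_mul, abs_of_nonneg (by positivity), mul_comm]
    gcongr
    refine hC _ ?_
    rw [mem_closedBall_zero_iff, norm_smul, norm_inv, norm_norm, inv_mul_cancel₀ hn]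

namespace EightMode

section Expansion

variable (ν r : ℝ)

/-- The linear part of `quadraticPart`. -/
noncomputable def linearTerm (y : Transverse) : ℝ :=
  (r ^ 2 - 1) / (16 * ν ^ 2) * (y.2.1 + y.2.2.1)
    - (r + 1) / (2 * ν) * (y.2.2.2.1.re - y.2.2.2.2.re)

/-- The homogeneous quadratic part of `quadraticPart`. -/
noncomputable def quadraticTerm (y : Transverse) : ℝ := quadraticPart ν r y - r - linearTerm ν r y

/-- The polar form of `quadraticTerm`. -/
noncomputable def polarTerm (y v : Transverse) : ℝ :=
  quadraticTerm ν r (y + v) - quadraticTerm ν r y - quadraticTerm ν r v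

/-- The linearization of the transverse equations at `fixedPoint r`. -/
noncomputable def transverseLinear (y : Transverse) : Transverse :=
  (-2 * ν * y.1, -4 * ν * y.2.1, -4 * ν * y.2.2.1,
    -2 * ν * y.2.2.2.1 + y.2.2.1 / 2 * (1 - r), -2 * ν * y.2.2.2.2 + y.2.1 / 2 * (r - 1))

/-- The coefficient of `R - r` in the transverse equations. -/
noncomputable def transverseCoupling (y : Transverse) : Transverse :=
  (0, 0, 0, -(y.2.2.1 / 2 : ℂ), (y.2.1 / 2 : ℂ))

/-- The quadratic terms of the transverse equations at `fixedPoint r`. -/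
noncomputable def transverseQuadratic (y : Transverse) : Transverse :=
  (3 / (20 * ν) * y.1 * (y.2.1 + y.2.2.1), -2 / (5 * ν) * y.2.1 * y.1, -2 / (5 * ν) * y.2.2.1 * y.1,
    -1 / (5 * ν) * y.2.2.2.1 * y.1 + y.2.2.2.1 * (y.2.2.2.1.re - y.2.2.2.2.re : ℝ)
      + y.2.2.2.1 / 2 * (conj y.2.2.2.2 - y.2.2.2.2 / r),
    -1 / (5 * ν) * y.2.2.2.2 * y.1 + y.2.2.2.2 * (y.2.2.2.1.re - y.2.2.2.2.re : ℝ)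
      + y.2.2.2.2 / 2 * (y.2.2.2.1 / r - conj y.2.2.2.1))

/-- The coefficient of `1 / r - 1 / R` in the transverse equations. -/
noncomputable def transverseProduct (y : Transverse) : Transverse :=
  (0, 0, 0, y.2.2.2.1 * y.2.2.2.2 / 2, -(y.2.2.2.2 * y.2.2.2.1 / 2))

/-- The expansion is exact: the only nonpolynomial dependence is on 1/R, and the last term isolates
it. -/
theorem reducedField_expand (R : ℝ) (y : Transverse) :
    (reducedField ν (R, y)).2 = transverseLinear ν r y + (R - r) • transverseCoupling y
      + transverseQuadratic ν r y + (r⁻¹ - R⁻¹) • transverseProduct y := by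
  obtain ⟨A, w, z, P, Q⟩ := y
  simp only [reducedField, transverseLinear, transverseCoupling, transverseQuadratic,
    transverseProduct, Prod.smul_mk, Prod.mk_add_mk, smul_eq_mul, Complex.real_smul]
  refine Prod.ext ?_ (Prod.ext ?_ (Prod.ext ?_ (Prod.ext ?_ ?_))) <;> simp only
  · ring
  · ring
  · ring
  · push_cast; ring
  · push_cast; ring

theorem linearTerm_add (y v : Transverse) :
    linearTerm ν r (y + v) = linearTerm ν r y + linearTerm ν r v := by
  simp only [linearTerm, Prod.fst_add, Prod.snd_add, Complex.add_re]; ring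

theorem linearTerm_smul (s : ℝ) (v : Transverse) :
    linearTerm ν r (s • v) = s * linearTerm ν r v := by
  simp only [linearTerm, Prod.smul_fst, Prod.smul_snd, Complex.smul_re, smul_eq_mul]; ring

theorem polarTerm_add (y u v : Transverse) :
    polarTerm ν r y (u + v) = polarTerm ν r y u + polarTerm ν r y v := by
  simp only [polarTerm, quadraticTerm, quadraticPart, linearTerm, Prod.fst_add, Prod.snd_add,
    Complex.add_re, Complex.add_im]
  ring

theorem polarTerm_smul (s : ℝ) (y v : Transverse) :
    polarTerm ν r y (s • v) = s * polarTerm ν r y v := by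
  simp only [polarTerm, quadraticTerm, quadraticPart, linearTerm, Prod.fst_add, Prod.snd_add,
    Complex.add_re, Complex.add_im, Prod.smul_fst, Prod.smul_snd, Complex.smul_re, Complex.smul_im,
    smul_eq_mul]
  ring

theorem quadraticTerm_smul (s : ℝ) (y : Transverse) :
    quadraticTerm ν r (s • y) = s ^ 2 * quadraticTerm ν r y := by
  simp only [quadraticTerm, quadraticPart, linearTerm, Prod.smul_fst, Prod.smul_snd,
    Complex.smul_re, Complex.smul_im, smul_eq_mul]
  ring

theorem polarTerm_smul_left (s : ℝ) (y v : Transverse) :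
    polarTerm ν r (s • y) v = s * polarTerm ν r y v := by
  have h : ∀ a b, polarTerm ν r a b = polarTerm ν r b a := fun a b => by
    simp only [polarTerm, add_comm a b]; ring
  rw [h, polarTerm_smul, h]

variable {ν r} in
-- The degree-one part of the invariance equation: the right-hand side is the linear part of the
-- derivative of `R` at `R = r`.
theorem linearTerm_transverseLinear (hν : ν ≠ 0) (y : Transverse) :
    linearTerm ν r (transverseLinear ν r y) = (1 + r) * (y.2.2.2.1.re - y.2.2.2.2.re) := by
  obtain ⟨A, w, z, P, Q⟩ := y
  have h1 : (-2 * (ν : ℂ) * P + z / 2 * (1 - r)).re = -2 * ν * P.re + z / 2 * (1 - r) := by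
    simp [← Complex.ofReal_one, ← Complex.ofReal_sub]
  have h2 : (-2 * (ν : ℂ) * Q + w / 2 * (r - 1)).re = -2 * ν * Q.re + w / 2 * (r - 1) := by
    simp [← Complex.ofReal_one, ← Complex.ofReal_sub]
  simp only [linearTerm, transverseLinear, h1, h2]
  field_simp
  ring

variable {ν r} in
-- The degree-two part of the invariance equation, with `R - r` replaced by its first-order value
-- `linearTerm`. This one identity checks all the quadratic coefficients of `quadraticPart`.
theorem second_order_identity (hν : ν ≠ 0) (hr : r ≠ 0) (y : Transverse) :
    linearTerm ν r y * (y.2.2.2.1.re - y.2.2.2.2.re - linearTerm ν r (transverseCoupling y)) =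
      linearTerm ν r (transverseQuadratic ν r y) + polarTerm ν r y (transverseLinear ν r y) := by
  obtain ⟨A, w, z, P, Q⟩ := y
  have h1 : (-2 * (ν : ℂ) * P + z / 2 * (1 - r)).re = -2 * ν * P.re + z / 2 * (1 - r) := by
    simp [← Complex.ofReal_one, ← Complex.ofReal_sub]
  have h1' : (-2 * (ν : ℂ) * P + z / 2 * (1 - r)).im = -2 * ν * P.im := by
    simp [← Complex.ofReal_one, ← Complex.ofReal_sub]
  have h2 : (-2 * (ν : ℂ) * Q + w / 2 * (r - 1)).re = -2 * ν * Q.re + w / 2 * (r - 1) := by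
    simp [← Complex.ofReal_one, ← Complex.ofReal_sub]
  have h2' : (-2 * (ν : ℂ) * Q + w / 2 * (r - 1)).im = -2 * ν * Q.im := by
    simp [← Complex.ofReal_one, ← Complex.ofReal_sub]
  have h3 : (-(z / 2 : ℂ)).re = -(z / 2) := by simp
  have h4 : ((w / 2 : ℂ)).re = w / 2 := by simp
  have e5 : (-1 / (5 * ν) * P * A + P * (P.re - Q.re : ℝ) + P / 2 * (conj Q - Q / r) : ℂ) =
      ((-1 / (5 * ν) * A + (P.re - Q.re) : ℝ) : ℂ) * P
        + ((1 / 2 : ℝ) : ℂ) * (P * conj Q) - ((1 / (2 * r) : ℝ) : ℂ) * (P * Q) := by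
    push_cast; ring
  have e6 : (-1 / (5 * ν) * Q * A + Q * (P.re - Q.re : ℝ) + Q / 2 * (P / r - conj P) : ℂ) =
      ((-1 / (5 * ν) * A + (P.re - Q.re) : ℝ) : ℂ) * Q
        + ((1 / (2 * r) : ℝ) : ℂ) * (P * Q) - ((1 / 2 : ℝ) : ℂ) * (Q * conj P) := by
    push_cast; ring
  simp only [linearTerm, transverseQuadratic, transverseCoupling, polarTerm, quadraticTerm,
    quadraticPart, transverseLinear, h3, h4, e5, e6, Prod.mk_add_mk, Complex.add_re,
    Complex.add_im, h1, h1', h2, h2', Complex.sub_re, Complex.mul_re, Complex.ofReal_re,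
    Complex.ofReal_im, Complex.conj_re, Complex.conj_im, zero_mul, sub_zero]
  field_simp
  ring

theorem continuous_linearTerm : Continuous (linearTerm ν r) := by
  unfold linearTerm; fun_prop

theorem continuous_quadraticTerm : Continuous (quadraticTerm ν r) := by
  have := continuous_linearTerm ν r
  unfold quadraticTerm quadraticPart; fun_prop

/-- The Taylor remainder at increment `v` is exactly `quadraticTerm ν r v`, hence O(‖v‖²). -/
theorem hasFDerivAt_quadraticPart (y : Transverse) :
    ∃ L : Transverse →L[ℝ] ℝ, (∀ v, L v = linearTerm ν r v + polarTerm ν r y v) ∧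
      HasFDerivAt (quadraticPart ν r) L y := by
  let L₀ : Transverse →ₗ[ℝ] ℝ :=
    { toFun := fun v => linearTerm ν r v + polarTerm ν r y v
      map_add' := fun u v => by rw [linearTerm_add, polarTerm_add]; ring
      map_smul' := fun s v => by
        rw [linearTerm_smul, polarTerm_smul, smul_eq_mul, RingHom.id_apply]; ring }
  refine ⟨LinearMap.toContinuousLinearMap L₀, fun v => rfl, ?_⟩
  obtain ⟨C, hC0, hC⟩ := exists_bound_of_homogeneous (continuous_quadraticTerm ν r) 2
    (quadraticTerm_smul ν r)
  have hq : ∀ x, quadraticPart ν r x = r + linearTerm ν r x + quadraticTerm ν r x := fun x => by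
    rw [quadraticTerm]; ring
  rw [hasFDerivAt_iff_isLittleO_nhds_zero]
  refine IsBigO.trans_isLittleO (g := fun h : Transverse => ‖h‖ ^ 2) ?_ ?_
  · refine IsBigO.of_bound C (Eventually.of_forall fun v => ?_)
    have : quadraticPart ν r (y + v) - quadraticPart ν r y - LinearMap.toContinuousLinearMap L₀ v =
        quadraticTerm ν r v := by
      change _ - _ - (linearTerm ν r v + polarTerm ν r y v) = _
      rw [hq, hq, linearTerm_add, polarTerm]; ring
    rw [this, Real.norm_eq_abs, norm_pow, norm_norm]
    exact hC v
  · exact isLittleO_norm_pow_id one_lt_two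

end Expansion

end EightMode

/-! ### The invariance defect and the cubic error bound -/

namespace EightMode

section Expansion

variable {ν r : ℝ}

/-- The defect of invariance of the graph of `quadraticPart` under the reduced system. -/
noncomputable def invarianceDefect (ν r : ℝ) (x : State) : ℝ :=
  (reducedField ν x).1 -
    (linearTerm ν r (reducedField ν x).2 + polarTerm ν r x.2 (reducedField ν x).2)

/-- Degrees one and two cancel by the two preceding identities. If `R - r` counts as order one,
every term left has order at least three or carries the factor `R - quadraticPart ν r y`. -/
theorem invarianceDefect_eq (hν : ν ≠ 0) (hr : r ≠ 0) (R : ℝ) (y : Transverse) :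
    invarianceDefect ν r (R, y) =
      (quadraticTerm ν r y + (R - quadraticPart ν r y)) *
        (y.2.2.2.1.re - y.2.2.2.2.re - linearTerm ν r (transverseCoupling y))
      - (r⁻¹ - R⁻¹) * linearTerm ν r (transverseProduct y)
      - (R - r) * polarTerm ν r y (transverseCoupling y)
      - polarTerm ν r y (transverseQuadratic ν r y)
      - (r⁻¹ - R⁻¹) * polarTerm ν r y (transverseProduct y) := by
  have h1 : (reducedField ν (R, y)).1 = (1 + R) * (y.2.2.2.1.re - y.2.2.2.2.re) := rfl
  have h2 := second_order_identity hν hr y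
  have h3 : quadraticPart ν r y = r + linearTerm ν r y + quadraticTerm ν r y := by
    rw [quadraticTerm]; ring
  rw [invarianceDefect, h1, reducedField_expand ν r]
  simp only [linearTerm_add, linearTerm_smul, polarTerm_add, polarTerm_smul,
    linearTerm_transverseLinear hν, h3]
  linear_combination h2

theorem continuous_transverseCoupling : Continuous transverseCoupling := by
  unfold transverseCoupling; fun_prop

theorem continuous_transverseProduct : Continuous transverseProduct := by
  unfold transverseProduct; fun_prop

theorem continuous_transverseQuadratic (ν r : ℝ) : Continuous (transverseQuadratic ν r) := by
  unfold transverseQuadratic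
  simp only [div_eq_mul_inv]
  fun_prop

theorem continuous_polarTerm (ν r : ℝ) :
    Continuous fun p : Transverse × Transverse => polarTerm ν r p.1 p.2 := by
  have cq := continuous_quadraticTerm ν r
  unfold polarTerm
  fun_prop

theorem transverseCoupling_smul (s : ℝ) (y : Transverse) :
    transverseCoupling (s • y) = s • transverseCoupling y := by
  simp only [transverseCoupling, Prod.smul_fst, Prod.smul_snd, Prod.smul_mk, smul_eq_mul,
    mul_zero, Complex.real_smul, Complex.ofReal_mul]
  refine Prod.ext rfl (Prod.ext rfl (Prod.ext rfl (Prod.ext ?_ ?_))) <;> simp only <;> ring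

theorem transverseProduct_smul (s : ℝ) (y : Transverse) :
    transverseProduct (s • y) = s ^ 2 • transverseProduct y := by
  simp only [transverseProduct, Prod.smul_fst, Prod.smul_snd, Prod.smul_mk, smul_eq_mul,
    mul_zero, Complex.real_smul, Complex.ofReal_pow]
  refine Prod.ext rfl (Prod.ext rfl (Prod.ext rfl (Prod.ext ?_ ?_))) <;> simp only <;> ring

theorem transverseQuadratic_smul (ν r s : ℝ) (y : Transverse) :
    transverseQuadratic ν r (s • y) = s ^ 2 • transverseQuadratic ν r y := by
  simp only [transverseQuadratic, Prod.smul_fst, Prod.smul_snd, Prod.smul_mk, smul_eq_mul,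
    Complex.real_smul, Complex.ofReal_pow, Complex.re_ofReal_mul, map_mul, Complex.conj_ofReal,
    Complex.ofReal_sub, Complex.ofReal_mul]
  refine Prod.ext ?_ (Prod.ext ?_ (Prod.ext ?_ (Prod.ext ?_ ?_))) <;> simp only <;> ring

/-- The polar form composed with a continuous homogeneous map is bounded by a power of the norm. -/
theorem exists_polarTerm_bound (ν r : ℝ) {v : Transverse → Transverse} (hv : Continuous v) (k : ℕ)
    (hk : ∀ (s : ℝ) y, v (s • y) = s ^ k • v y) :
    ∃ C, 0 ≤ C ∧ ∀ y, |polarTerm ν r y (v y)| ≤ C * ‖y‖ ^ (k + 1) :=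
  exists_bound_of_homogeneous ((continuous_polarTerm ν r).comp (continuous_id.prodMk hv)) (k + 1)
    (fun s y => by
      simp only [Function.comp, id]
      rw [hk, polarTerm_smul, polarTerm_smul_left]; ring)

/-- The linear form composed with a continuous homogeneous map is bounded by a power of the
norm. -/
theorem exists_linearTerm_bound (ν r : ℝ) {v : Transverse → Transverse} (hv : Continuous v) (k : ℕ)
    (hk : ∀ (s : ℝ) y, v (s • y) = s ^ k • v y) :
    ∃ C, 0 ≤ C ∧ ∀ y, |linearTerm ν r (v y)| ≤ C * ‖y‖ ^ k :=
  exists_bound_of_homogeneous ((continuous_linearTerm ν r).comp hv) k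
    (fun s y => by
      simp only [Function.comp]
      rw [hk, linearTerm_smul])

theorem exists_difference_bound (ν r : ℝ) : ∃ C, 0 ≤ C ∧ ∀ y : Transverse,
    |y.2.2.2.1.re - y.2.2.2.2.re - linearTerm ν r (transverseCoupling y)| ≤ C * ‖y‖ ^ 1 := by
  have h1 := (continuous_linearTerm ν r).comp continuous_transverseCoupling
  refine exists_bound_of_homogeneous (f := fun y : Transverse =>
    y.2.2.2.1.re - y.2.2.2.2.re - linearTerm ν r (transverseCoupling y)) ?_ 1 fun s y => ?_
  · exact Continuous.sub (by fun_prop) h1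
  · rw [transverseCoupling_smul, linearTerm_smul]
    simp only [Prod.smul_snd, Prod.smul_fst, Complex.smul_re, smul_eq_mul]
    ring

/-- Each term of `invarianceDefect_eq` is a product of homogeneous factors, bounded by powers of
`σ`, the common bound for ‖y‖ and |R - r|. -/
theorem exists_invarianceDefect_bound (hν : ν ≠ 0) (hr : 0 < r) :
    ∃ C, 0 ≤ C ∧ ∀ σ R y, 0 ≤ σ → σ ≤ 1 → σ ≤ r / 2 → ‖y‖ ≤ σ → |R - r| ≤ σ →
      |R - quadraticPart ν r y| ≤ C * σ ∧
      |invarianceDefect ν r (R, y)| ≤ C * (σ ^ 3 + |R - quadraticPart ν r y| * σ) := by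
  obtain ⟨c₀, h0, b0⟩ := exists_linearTerm_bound ν r continuous_id 1 (fun s y => by simp)
  obtain ⟨c₁, h1, b1⟩ := exists_bound_of_homogeneous (continuous_quadraticTerm ν r) 2
    (quadraticTerm_smul ν r)
  obtain ⟨c₂, h2, b2⟩ := exists_difference_bound ν r
  obtain ⟨c₃, h3, b3⟩ := exists_linearTerm_bound ν r continuous_transverseProduct 2
    transverseProduct_smul
  obtain ⟨c₄, h4, b4⟩ := exists_polarTerm_bound ν r continuous_transverseCoupling 1
    (fun s y => by rw [transverseCoupling_smul, pow_one])
  obtain ⟨c₅, h5, b5⟩ := exists_polarTerm_bound ν r (continuous_transverseQuadratic ν r) 2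
    (transverseQuadratic_smul ν r)
  obtain ⟨c₆, h6, b6⟩ := exists_polarTerm_bound ν r continuous_transverseProduct 2
    transverseProduct_smul
  -- Since R ≥ r/2, |1/r - 1/R| = |R - r|/(rR) ≤ (2/r²)|R - r|.
  set k := 2 / r ^ 2 with hk
  have hk0 : 0 ≤ k := by positivity
  refine ⟨(1 + c₀ + c₁) + (c₁ * c₂ + c₂ + k * c₃ + c₄ + c₅ + k * c₆), by positivity, ?_⟩
  intro σ R y hσ hσ1 hσr hy hR
  have hσ2 : σ ^ 2 ≤ σ := by nlinarith
  have b0' : |linearTerm ν r y| ≤ c₀ * σ := (b0 y).trans (by rw [pow_one]; gcongr)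
  have b1' : |quadraticTerm ν r y| ≤ c₁ * σ ^ 2 := (b1 y).trans (by gcongr)
  have b2' := (b2 y).trans (show _ ≤ c₂ * σ by rw [pow_one]; gcongr)
  have b3' := (b3 y).trans (show _ ≤ c₃ * σ ^ 2 by gcongr)
  have b4' := (b4 y).trans (show _ ≤ c₄ * σ ^ 2 by gcongr)
  have b5' := (b5 y).trans (show _ ≤ c₅ * σ ^ 3 by gcongr)
  have b6' := (b6 y).trans (show _ ≤ c₆ * σ ^ 2 by
    have : ‖y‖ ^ 3 ≤ σ ^ 2 := calc
      ‖y‖ ^ 3 ≤ σ ^ 3 := by gcongr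
      _ = σ ^ 2 * σ := by ring
      _ ≤ σ ^ 2 := mul_le_of_le_one_right (by positivity) hσ1
    gcongr)
  have hRr : r / 2 ≤ R := by have := (abs_le.1 hR).1; linarith
  have hR0 : 0 < R := by linarith
  have he : |r⁻¹ - R⁻¹| ≤ k * σ := by
    have h7 : r⁻¹ - R⁻¹ = (R - r) * (r * R)⁻¹ := by field_simp
    rw [h7, abs_mul, abs_of_pos (by positivity : 0 < (r * R)⁻¹), mul_comm]
    refine mul_le_mul ?_ hR (abs_nonneg _) hk0
    rw [hk, inv_le_comm₀ (by positivity) (by positivity), inv_div]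
    nlinarith
  constructor
  · have h8 : R - quadraticPart ν r y = (R - r) - linearTerm ν r y - quadraticTerm ν r y := by
      rw [quadraticTerm]; ring
    rw [h8]
    have h9 : |(R - r) - linearTerm ν r y - quadraticTerm ν r y| ≤ σ + c₀ * σ + c₁ * σ ^ 2 :=
      (abs_sub _ _).trans (add_le_add ((abs_sub _ _).trans (add_le_add hR b0')) b1')
    refine h9.trans ?_
    have h10 : 0 ≤ (c₁ * c₂ + c₂ + k * c₃ + c₄ + c₅ + k * c₆) * σ := by positivity
    have h11 : c₁ * σ ^ 2 ≤ c₁ * σ := by gcongr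
    linarith
  · rw [invarianceDefect_eq hν hr.ne']
    set h := R - quadraticPart ν r y with hh
    have t1 : |(quadraticTerm ν r y + h) * (y.2.2.2.1.re - y.2.2.2.2.re
        - linearTerm ν r (transverseCoupling y))| ≤ (c₁ * σ ^ 2 + |h|) * (c₂ * σ) := by
      rw [abs_mul]
      exact mul_le_mul ((abs_add_le _ _).trans (by gcongr)) b2' (abs_nonneg _) (by positivity)
    have t2 : |(r⁻¹ - R⁻¹) * linearTerm ν r (transverseProduct y)| ≤ (k * σ) * (c₃ * σ ^ 2) := by
      rw [abs_mul]; exact mul_le_mul he b3' (abs_nonneg _) (by positivity)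
    have t3 : |(R - r) * polarTerm ν r y (transverseCoupling y)| ≤ σ * (c₄ * σ ^ 2) := by
      rw [abs_mul]; exact mul_le_mul hR b4' (abs_nonneg _) hσ
    have t4 : |(r⁻¹ - R⁻¹) * polarTerm ν r y (transverseProduct y)| ≤ (k * σ) * (c₆ * σ ^ 2) := by
      rw [abs_mul]; exact mul_le_mul he b6' (abs_nonneg _) (by positivity)
    refine (abs_sub _ _).trans (le_trans (add_le_add ((abs_sub _ _).trans (add_le_add
      ((abs_sub _ _).trans (add_le_add ((abs_sub _ _).trans (add_le_add t1 t2)) t3)) b5')) t4) ?_)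
    have p1 : 0 ≤ (1 + c₀ + c₁) * (σ ^ 3 + |h| * σ) := by positivity
    have p2 : 0 ≤ (c₁ * c₂ + k * c₃ + c₄ + c₅ + k * c₆) * (|h| * σ) := by positivity
    have p3 : 0 ≤ c₂ * σ ^ 3 := by positivity
    linarith

/-- Bootstrap from infinity. The difference h between `R` and `quadraticPart` tends to 0 and
satisfies |h'| ≤ C(σ³ + |h|σ) with σ = c s e^{-κt}. The crude bound |h| ≤ Cσ gives h' = O(σ²), so h
= O(σ²); then h' = O(σ³), so h(0) = O(s³). -/
theorem exists_cubic_bound (hν : ν ≠ 0) (hr : 0 < r) {κ c : ℝ} (hκ : 0 < κ) (hc : 0 < c) :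
    ∃ C, ∃ s₀ > 0, ∀ X : ℝ → State, IsReducedSolution ν X → ∀ s, 0 ≤ s → s ≤ s₀ →
      (∀ t, 0 ≤ t → ‖X t - fixedPoint r‖ ≤ c * s * Real.exp (-κ * t)) →
      |(X 0).1 - quadraticPart ν r (X 0).2| ≤ C * s ^ 3 := by
  obtain ⟨C, hC, hb⟩ := exists_invarianceDefect_bound hν hr
  -- The factors 1/(2κ) and 1/(3κ) come from the two integrations. The threshold on `s` ensures σ ≤
  -- 1 and σ ≤ r/2.
  refine ⟨C * (1 + C * (1 + C) / (2 * κ)) * c ^ 3 / (3 * κ), min 1 (r / 2) / c,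
    by positivity, fun X hX s hs hs0 hXs => ?_⟩
  set σ : ℝ → ℝ := fun t => c * s * Real.exp (-κ * t) with hσ
  have hσ0 : ∀ t, 0 ≤ σ t := fun t => by positivity
  have hcs : c * s ≤ min 1 (r / 2) := by rw [mul_comm]; exact (le_div_iff₀ hc).1 hs0
  have hσle : ∀ t, 0 ≤ t → σ t ≤ c * s := fun t ht =>
    mul_le_of_le_one_right (by positivity) (Real.exp_le_one_iff.2 (by nlinarith))
  set h : ℝ → ℝ := fun t => (X t).1 - quadraticPart ν r (X t).2 with hh
  have hbt : ∀ t, 0 ≤ t → |h t| ≤ C * σ t ∧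
      |invarianceDefect ν r (X t)| ≤ C * (σ t ^ 3 + |h t| * σ t) := by
    intro t ht
    have h1 := hXs t ht
    rw [Prod.norm_def, max_le_iff] at h1
    refine hb (σ t) (X t).1 (X t).2 (hσ0 t) ((hσle t ht).trans (hcs.trans (min_le_left _ _)))
      ((hσle t ht).trans (hcs.trans (min_le_right _ _))) ?_ ?_
    · simpa only [fixedPoint, Prod.snd_sub, sub_zero] using h1.2
    · exact h1.1
  have hd : ∀ t, 0 ≤ t → HasDerivWithinAt h (invarianceDefect ν r (X t)) (Ici 0) t := by
    intro t ht
    obtain ⟨L, hL, hLd⟩ := hasFDerivAt_quadraticPart ν r (X t).2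
    have h1 := hasDerivWithinAt_fst (hX t ht).2
    have h2 := hLd.comp_hasDerivWithinAt t (hasDerivWithinAt_snd (hX t ht).2)
    refine (h1.sub h2).congr_deriv ?_
    rw [hL, invarianceDefect]
  have hσlim : Tendsto σ atTop (𝓝 0) := by
    have h1 : Tendsto (fun s => -κ * s) atTop atBot :=
      tendsto_id.const_mul_atTop_of_neg (by linarith)
    have h2 := (Real.tendsto_exp_atBot.comp h1).const_mul (c * s)
    rwa [mul_zero] at h2
  have hlim : Tendsto h atTop (𝓝 0) := by
    refine squeeze_zero_norm' ?_ (by simpa using hσlim.const_mul C)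
    filter_upwards [eventually_ge_atTop 0] with t ht using (hbt t ht).1
  have hpow : ∀ (n : ℕ) t, σ t ^ n = (c * s) ^ n * Real.exp (-(n * κ) * t) := by
    intro n t
    rw [hσ]
    simp only
    rw [mul_pow, ← Real.exp_nat_mul]
    ring_nf
  have hstep2 : ∀ t, 0 ≤ t → |h t| ≤ C * (1 + C) / (2 * κ) * σ t ^ 2 := by
    intro t ht
    have h1 := abs_le_of_abs_deriv_le_exp (B := C * (1 + C) * (c * s) ^ 2) (c := 2 * κ)
      (by positivity) hd (fun u hu => ?_) hlim ht
    · refine h1.trans (le_of_eq ?_)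
      rw [hpow 2 t]
      push_cast
      ring
    · obtain ⟨h2, h3⟩ := hbt u hu
      have h4 : C * (1 + C) * (c * s) ^ 2 * Real.exp (-(2 * κ) * u) = C * (1 + C) * σ u ^ 2 := by
        rw [hpow 2 u]; push_cast; ring
      rw [h4]
      refine h3.trans ?_
      have h5 : σ u ≤ 1 := (hσle u hu).trans (hcs.trans (min_le_left _ _))
      have h6 : σ u ^ 3 ≤ σ u ^ 2 := pow_le_pow_of_le_one (hσ0 u) h5 (by norm_num)
      have h7 : |h u| * σ u ≤ C * σ u * σ u := by gcongr
      have h8 : σ u ^ 3 + |h u| * σ u ≤ (1 + C) * σ u ^ 2 := by nlinarith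
      calc C * (σ u ^ 3 + |h u| * σ u) ≤ C * ((1 + C) * σ u ^ 2) := by gcongr
        _ = _ := by ring
  have h1 := abs_le_of_abs_deriv_le_exp (B := C * (1 + C * (1 + C) / (2 * κ)) * (c * s) ^ 3)
    (c := 3 * κ) (by positivity) hd (fun u hu => ?_) hlim le_rfl
  · refine h1.trans (le_of_eq ?_)
    rw [mul_zero, Real.exp_zero]
    ring
  · have h3 := (hbt u hu).2
    have h4 : C * (1 + C * (1 + C) / (2 * κ)) * (c * s) ^ 3 * Real.exp (-(3 * κ) * u) =
        C * (σ u ^ 3 + C * (1 + C) / (2 * κ) * σ u ^ 2 * σ u) := by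
      have := hpow 3 u
      push_cast at this
      rw [show C * (σ u ^ 3 + C * (1 + C) / (2 * κ) * σ u ^ 2 * σ u) =
        C * (1 + C * (1 + C) / (2 * κ)) * σ u ^ 3 by ring, this]
      ring
    rw [h4]
    refine h3.trans ?_
    gcongr
    exact hstep2 u hu

end Expansion

end EightMode

/-! ### The local stable manifold -/

namespace EightMode

/-- The local stable manifold of `fixedPoint r`, its quadratic expansion, and the selection of a
fixed point by every nearby trajectory. -/
theorem exists_local_stable_manifold {ν r : ℝ} (hν : 0 < ν) (hr : 0 < r) :
    ∃ f : Transverse → ℝ,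
      (fun y => f y - quadraticPart ν r y) =O[𝓝 0] (fun y => ‖y‖ ^ 3) ∧
      ∃ (V : Set Transverse) (U : Set State) (C κ : ℝ),
        IsOpen V ∧ 0 ∈ V ∧ ContDiffOn ℝ ∞ f V ∧ f 0 = r ∧
        IsOpen U ∧ fixedPoint r ∈ U ∧ 0 < C ∧ 0 < κ ∧
        (∀ x ∈ graphOver f V,
          (∃ X : ℝ → State, IsReducedSolution ν X ∧ X 0 = x) ∧
          ∀ X : ℝ → State, IsReducedSolution ν X → X 0 = x →
            ∀ t, 0 ≤ t → X t ∈ graphOver f V ∧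
              ‖X t - fixedPoint r‖ ≤ C * ‖x - fixedPoint r‖ * Real.exp (-κ * t)) ∧
        (∀ x ∈ U, x ∈ graphOver f V ↔
          ∃ X : ℝ → State, IsReducedSolution ν X ∧ X 0 = x ∧
            Tendsto X atTop (𝓝 (fixedPoint r))) ∧
        (∀ x ∈ U,
          (∃ X : ℝ → State, IsReducedSolution ν X ∧ X 0 = x) ∧
          ∀ X : ℝ → State, IsReducedSolution ν X → X 0 = x →
            ∃ r' : ℝ, 0 < r' ∧ ∀ t, 0 ≤ t →
              ‖X t - fixedPoint r'‖ ≤ C * Real.exp (-κ * t)) := by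
  obtain ⟨S, δ, hδ, K, hK, hδr, hSs, hSo, ⟨e, hes, hee, hesm⟩, hSL, hSinv, hSfix, hflow⟩ :=
    exists_chart hν hr
  set p := fixedPoint r with hp
  have hpδ : p ∈ Metric.ball p δ := Metric.mem_ball_self hδ
  have hball : ∀ a : Transverse, a ∈ Metric.ball (0 : Transverse) δ ↔
      ((r, a) : State) ∈ Metric.ball p δ := by
    intro a
    have hd : dist ((r, a) : State) p = dist a 0 := by
      rw [hp, fixedPoint, Prod.dist_eq]
      simp only [dist_self]
      exact max_eq_right dist_nonneg
    rw [Metric.mem_ball, Metric.mem_ball, hd]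
  -- Here `e` inverts the transverse part of the chart on the slice over `r`, so `f` gives the
  -- `R`-value of the point of that slice lying over `y`.
  set f : Transverse → ℝ := fun y => (S (r, e.symm y)).1 with hf
  set V := e.target with hV
  have hSp : S p = p := hSfix r hpδ
  have h0s : (0 : Transverse) ∈ e.source := by rw [hes]; exact Metric.mem_ball_self hδ
  have he0 : e 0 = 0 := by
    rw [hee]
    change (S p).2 = 0
    rw [hSp]; rfl
  have hes0 : e.symm 0 = 0 := by
    have h1 := e.left_inv h0s
    rwa [he0] at h1
  have hsymm : ∀ y ∈ V, e.symm y ∈ Metric.ball (0 : Transverse) δ := fun y hy => by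
    rw [← hes]; exact e.map_target hy
  -- the graph of `f` is the image of a slice of the chart
  have hgraph : ∀ a ∈ Metric.ball (0 : Transverse) δ, S (r, a) ∈ graphOver f V := by
    intro a ha
    rw [← hes] at ha
    refine ⟨?_, ?_⟩
    · rw [← hee]; exact e.map_source ha
    · rw [hf]
      simp only
      rw [← hee, e.left_inv ha]
  have hgraph' : ∀ x ∈ graphOver f V, ∃ a ∈ Metric.ball (0 : Transverse) δ, x = S (r, a) := by
    intro x hx
    refine ⟨e.symm x.2, hsymm _ hx.1, Prod.ext hx.2 ?_⟩
    rw [← hee, e.right_inv hx.1]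
  have hμ1 : ∀ {m t : ℝ}, 0 ≤ t → m ≤ Real.exp (-ν * t) → m ≤ 1 := fun ht h =>
    h.trans (Real.exp_le_one_iff.2 (by nlinarith))
  have hfixmem : ∀ x ∈ Metric.ball p δ, fixedPoint x.1 ∈ Metric.ball p δ := by
    intro x hx
    rw [Metric.mem_ball, Prod.dist_eq, max_lt_iff] at hx ⊢
    exact ⟨hx.1, by simp [hp, fixedPoint, hδ]⟩
  -- every trajectory from the image of the chart
  have htraj : ∀ x ∈ Metric.ball p δ, ∃ μ : ℝ → ℝ,
      (∀ t, 0 ≤ t → 0 < μ t ∧ μ t ≤ Real.exp (-ν * t)) ∧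
      (∃ X : ℝ → State, IsReducedSolution ν X ∧ X 0 = S x) ∧
      ∀ X : ℝ → State, IsReducedSolution ν X → X 0 = S x → ∀ t, 0 ≤ t →
        X t = S (scaling (μ t) x) ∧
        ‖X t - fixedPoint x.1‖ ≤ K * ‖x.2‖ * Real.exp (-ν * t) := by
    intro x hx
    obtain ⟨μ, hμ0, hμ, X, hX, hXt⟩ := hflow x hx
    have hX0 : X 0 = S x := by rw [hXt 0 le_rfl, hμ0, scaling_one]
    refine ⟨μ, hμ, ⟨X, hX, hX0⟩, fun Y hY hY0 t ht => ?_⟩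
    have h1 : Y t = S (scaling (μ t) x) := by
      rw [hY.eq hX (hY0.trans hX0.symm) ht, hXt t ht]
    refine ⟨h1, ?_⟩
    have hm := hμ t ht
    have h2 := hSL _ (scaling_mem_ball hm.1.le (hμ1 ht hm.2) hx) _ (hfixmem x hx)
    rw [hSfix _ (hfixmem x hx)] at h2
    rw [h1]
    refine h2.trans ?_
    have h3 : ‖scaling (μ t) x - fixedPoint x.1‖ ≤ Real.exp (-ν * t) * ‖x.2‖ := by
      rw [Prod.norm_def, max_le_iff]
      constructor
      · simp only [scaling, fixedPoint, Prod.fst_sub, sub_self, norm_zero]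
        positivity
      · simp only [scaling, fixedPoint, Prod.snd_sub, sub_zero]
        refine (norm_transverseScaling_le hm.1.le (hμ1 ht hm.2) x.2).trans ?_
        gcongr
        exact hm.2
    calc K * ‖scaling (μ t) x - fixedPoint x.1‖ ≤ K * (Real.exp (-ν * t) * ‖x.2‖) := by gcongr
      _ = _ := by ring
  have hexplim : Tendsto (fun t => Real.exp (-ν * t)) atTop (𝓝 0) :=
    Real.tendsto_exp_atBot.comp (tendsto_id.const_mul_atTop_of_neg (by linarith))
  -- trajectories on the graph
  have hstable : ∀ x ∈ graphOver f V,
      (∃ X : ℝ → State, IsReducedSolution ν X ∧ X 0 = x) ∧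
      ∀ X : ℝ → State, IsReducedSolution ν X → X 0 = x →
        ∀ t, 0 ≤ t → X t ∈ graphOver f V ∧
          ‖X t - fixedPoint r‖ ≤ K * K * ‖x.2‖ * Real.exp (-ν * t) := by
    intro x hx
    obtain ⟨a, ha, rfl⟩ := hgraph' x hx
    have hra := (hball a).1 ha
    obtain ⟨μ, hμ, hex, hall⟩ := htraj _ hra
    refine ⟨hex, fun X hX hX0 t ht => ?_⟩
    obtain ⟨h1, h2⟩ := hall X hX hX0 t ht
    have hm := hμ t ht
    refine ⟨?_, h2.trans ?_⟩
    · rw [h1]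
      exact hgraph _ ((hball _).2 (scaling_mem_ball hm.1.le (hμ1 ht hm.2) hra))
    · have h3 := hSinv a ha
      have h4 : K * ‖a‖ ≤ K * (K * ‖(S (r, a)).2‖) := by gcongr
      have h5 := mul_le_mul_of_nonneg_right h4 (Real.exp_pos (-ν * t)).le
      refine h5.trans (le_of_eq ?_)
      ring
  have hsnd : ∀ x : State, ‖x.2‖ ≤ ‖x - fixedPoint r‖ := fun x => by
    have h1 := norm_snd_le (x - fixedPoint r)
    simpa only [fixedPoint, Prod.snd_sub, sub_zero] using h1
  -- In the constant, K·K bounds trajectories on the graph (Lipschitz bound of the chart and of its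
  -- inverse), and K·δ bounds those from any point of the neighbourhood.
  refine ⟨f, ?_, V, S '' Metric.ball p δ, K * K + K * δ, ν, e.open_target, ?_, ?_, ?_, hSo,
    ⟨p, hpδ, hSp⟩, by positivity, hν, ?_, ?_, ?_⟩
  · obtain ⟨C, s₀, hs₀, hC⟩ := exists_cubic_bound hν.ne' hr hν (c := K * K) (by positivity)
    refine IsBigO.of_bound C ?_
    have h0V : (0 : Transverse) ∈ V := by have := e.map_source h0s; rwa [he0] at this
    filter_upwards [e.open_target.mem_nhds h0V, Metric.ball_mem_nhds (0 : Transverse) hs₀]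
      with y hyV hys
    have hx : ((f y, y) : State) ∈ graphOver f V := ⟨hyV, rfl⟩
    obtain ⟨⟨X, hX, hX0⟩, hall⟩ := hstable _ hx
    rw [mem_ball_zero_iff] at hys
    have h1 := hC X hX ‖y‖ (norm_nonneg y) hys.le (fun t ht => (hall X hX hX0 t ht).2)
    rw [hX0] at h1
    rw [Real.norm_eq_abs, Real.norm_of_nonneg (by positivity)]
    exact h1
  · have := e.map_source h0s
    rwa [he0] at this
  · exact contDiff_fst.comp_contDiffOn (hSs.comp
      (contDiffOn_const.prodMk hesm) fun y hy => (hball _).1 (hsymm y hy))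
  · rw [hf]
    simp only [hes0]
    exact congrArg Prod.fst hSp
  · intro x hx
    obtain ⟨hex, hall⟩ := hstable x hx
    refine ⟨hex, fun X hX hX0 t ht => ⟨(hall X hX hX0 t ht).1, ((hall X hX hX0 t ht).2).trans ?_⟩⟩
    gcongr
    · nlinarith
    · exact hsnd x
  · rintro _ ⟨x, hx, rfl⟩
    obtain ⟨μ, hμ, hex, hall⟩ := htraj x hx
    constructor
    · intro hg
      obtain ⟨⟨X, hX, hX0⟩, hall'⟩ := hstable _ hg
      refine ⟨X, hX, hX0, ?_⟩
      rw [tendsto_iff_norm_sub_tendsto_zero]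
      refine squeeze_zero' (Eventually.of_forall fun t => norm_nonneg _) ?_
        (by simpa only [mul_zero] using hexplim.const_mul (K * K * ‖(S x).2‖))
      filter_upwards [eventually_ge_atTop 0] with t ht using (hall' X hX hX0 t ht).2
    -- The trajectory also converges to `fixedPoint x.1`, so uniqueness of limits puts `x` on the
    -- slice over `r`.
    · rintro ⟨X, hX, hX0, hlim⟩
      have hlim' : Tendsto X atTop (𝓝 (fixedPoint x.1)) := by
        rw [tendsto_iff_norm_sub_tendsto_zero]
        refine squeeze_zero' (Eventually.of_forall fun t => norm_nonneg _) ?_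
          (by simpa only [mul_zero] using hexplim.const_mul (K * ‖x.2‖))
        filter_upwards [eventually_ge_atTop 0] with t ht using (hall X hX hX0 t ht).2
      have hxr : x.1 = r := congrArg Prod.fst (tendsto_nhds_unique hlim' hlim)
      have hx' : x = (r, x.2) := Prod.ext hxr rfl
      rw [hx']
      exact hgraph _ ((hball _).2 (by rwa [← hx']))
  · rintro _ ⟨x, hx, rfl⟩
    obtain ⟨μ, hμ, hex, hall⟩ := htraj x hx
    refine ⟨hex, fun X hX hX0 => ⟨x.1, ?_, fun t ht => ((hall X hX hX0 t ht).2).trans ?_⟩⟩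
    · rw [Metric.mem_ball, Prod.dist_eq, max_lt_iff] at hx
      have h1 : |x.1 - r| < δ := hx.1
      have := (abs_lt.1 h1).1
      linarith
    · rw [Metric.mem_ball, Prod.dist_eq, max_lt_iff] at hx
      have h1 : ‖x.2‖ < δ := by simpa only [hp, fixedPoint, dist_zero_right] using hx.2
      gcongr
      nlinarith

end EightMode

/-! ### The coupling flow and the exceptional null set -/

namespace EightMode

noncomputable section

/-- The real-linear coupling of `(ω₁, ω₃)` by the frozen modes `m = (ω₅, ω₇)`. -/
def coupling (m : ℂ × ℂ) : (ℂ × ℂ) →L[ℝ] ℂ × ℂ :=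
  m.2 • (ContinuousLinearMap.inl ℝ ℂ ℂ ∘L ContinuousLinearMap.snd ℝ ℂ ℂ) -
    m.1 • (ContinuousLinearMap.inl ℝ ℂ ℂ ∘L (Complex.conjCLE : ℂ →L[ℝ] ℂ) ∘L
      ContinuousLinearMap.snd ℝ ℂ ℂ) +
    (m.1 • (ContinuousLinearMap.inr ℝ ℂ ℂ ∘L (Complex.conjCLE : ℂ →L[ℝ] ℂ) ∘L
      ContinuousLinearMap.fst ℝ ℂ ℂ) -
    conj m.2 • (ContinuousLinearMap.inr ℝ ℂ ℂ ∘L ContinuousLinearMap.fst ℝ ℂ ℂ))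

theorem coupling_apply (m v : ℂ × ℂ) :
    coupling m v = (m.2 * v.2 - m.1 * conj v.2, m.1 * conj v.1 - conj m.2 * v.1) := by
  simp [coupling]

theorem differentiable_coupling : Differentiable ℝ coupling := by
  have h : Differentiable ℝ fun m : ℂ × ℂ => conj m.2 :=
    (Complex.conjCLE : ℂ →L[ℝ] ℂ).differentiable.comp differentiable_snd
  unfold coupling
  fun_prop

/-- The flow of the coupling, after time `θ`. -/
def couplingFlow (θ : ℝ) (m : ℂ × ℂ) : (ℂ × ℂ) →L[ℝ] ℂ × ℂ := NormedSpace.exp (θ • coupling m)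

theorem couplingFlow_zero (m v : ℂ × ℂ) : couplingFlow 0 m v = v := by
  rw [couplingFlow, zero_smul ℝ (coupling m), NormedSpace.exp_zero, one_apply_eq_self]

theorem differentiable_couplingFlow :
    Differentiable ℝ fun p : ℝ × (ℂ × ℂ) => couplingFlow p.1 p.2 := by
  have h : Differentiable ℝ fun p : ℝ × (ℂ × ℂ) => p.1 • coupling p.2 :=
    Differentiable.fun_smul differentiable_fst (differentiable_coupling.comp differentiable_snd)
  intro p
  exact (NormedSpace.exp_analytic (𝕂 := ℝ) (p.1 • coupling p.2)).differentiableAt.comp p (h p)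

theorem couplingFlow_neg_apply (θ : ℝ) (m v : ℂ × ℂ) :
    couplingFlow (-θ) m (couplingFlow θ m v) = v := by
  let _ : NormedAlgebra ℚ ((ℂ × ℂ) →L[ℝ] ℂ × ℂ) := NormedAlgebra.restrictScalars ℚ ℝ _
  have h : couplingFlow (-θ) m * couplingFlow θ m = 1 := by
    rw [couplingFlow, couplingFlow, ← NormedSpace.exp_add_of_commute, ← add_smul (-θ) θ (coupling m),
      neg_add_cancel, zero_smul ℝ (coupling m), NormedSpace.exp_zero]
    exact ContinuousLinearMap.ext fun w => by
      simp only [mul_apply_eq_comp, smul_apply, map_smul]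
      exact smul_comm _ _ _
  rw [← mul_apply_eq_comp, h, one_apply_eq_self]

theorem hasDerivAt_couplingFlow (m v : ℂ × ℂ) (θ : ℝ) :
    HasDerivAt (fun s => couplingFlow s m v) (coupling m (couplingFlow θ m v)) θ :=
  ((ContinuousLinearMap.apply ℝ (ℂ × ℂ) v).hasFDerivAt.comp_hasDerivAt θ
    (hasDerivAt_exp_smul_const' (coupling m) θ))

/-- The coupling is skew for the real inner product. Hence it does not affect |ω₁|² + |ω₃|², whose
evolution can be solved separately. -/
theorem norm_sq_couplingFlow (m v : ℂ × ℂ) (θ : ℝ) :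
    ‖(couplingFlow θ m v).1‖ ^ 2 + ‖(couplingFlow θ m v).2‖ ^ 2 = ‖v.1‖ ^ 2 + ‖v.2‖ ^ 2 := by
  have hd : ∀ s, HasDerivAt (fun s => ‖(couplingFlow s m v).1‖ ^ 2 + ‖(couplingFlow s m v).2‖ ^ 2)
      0 s := by
    intro s
    have h := (hasDerivAt_couplingFlow m v s).hasDerivWithinAt (s := univ)
    have h' := (hasDerivWithinAt_norm_sq (hasDerivWithinAt_fst h)).add
      (hasDerivWithinAt_norm_sq (hasDerivWithinAt_snd h))
    rw [hasDerivWithinAt_univ] at h'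
    refine h'.congr_deriv ?_
    rw [coupling_apply]
    simp only [Complex.mul_re, Complex.sub_re, Complex.sub_im, Complex.mul_im, Complex.conj_re,
      Complex.conj_im]
    ring
  have h := is_const_of_deriv_eq_zero (fun s => (hd s).differentiableAt) (fun s => (hd s).deriv) θ 0
  simpa only [couplingFlow_zero] using h

instance : (volume : Measure (ℂ × ℂ)).IsAddHaarMeasure :=
  Measure.prod.instIsAddHaarMeasure _ _

instance : (volume : Measure (ℂ × ℂ × ℂ)).IsAddHaarMeasure :=
  Measure.prod.instIsAddHaarMeasure _ _

instance : (volume : Measure Modes).IsAddHaarMeasure :=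
  Measure.prod.instIsAddHaarMeasure _ _

/-- A complex linear condition on the coupling flow at some time excludes only a null set of data:
the time contributes one real dimension, the condition removes two. -/
theorem volume_exists_couplingFlow_mem_range (j : ℂ →L[ℝ] ℂ × ℂ) :
    volume {u : Modes | ∃ θ : ℝ, couplingFlow θ u.2.2 (u.1, u.2.1) ∈ range j} = 0 := by
  -- The bad data are parametrized by (θ, b, m). Storing θ as the real part of a complex coordinate
  -- makes `Φ` a differentiable self-map of `Modes`, and the bad set lies in the image of the null
  -- hyperplane where that coordinate is real.
  set Φ : Modes → Modes := fun u =>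
    ((couplingFlow u.1.re u.2.2 (j u.2.1)).1, (couplingFlow u.1.re u.2.2 (j u.2.1)).2, u.2.2)
    with hΦ
  have hdiff : Differentiable ℝ Φ := by
    have h0 : Differentiable ℝ fun u : Modes => u.1.re :=
      Complex.reCLM.differentiable.comp differentiable_fst
    have h1 : Differentiable ℝ fun u : Modes => (u.1.re, u.2.2) :=
      h0.prodMk (differentiable_snd.comp differentiable_snd)
    have h2 : Differentiable ℝ fun u : Modes => j u.2.1 :=
      j.differentiable.comp (differentiable_fst.comp differentiable_snd)
    have h3 : Differentiable ℝ fun u : Modes => couplingFlow u.1.re u.2.2 (j u.2.1) :=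
      (differentiable_couplingFlow.comp h1).clm_apply h2
    exact h3.fst.prodMk (h3.snd.prodMk (differentiable_snd.comp differentiable_snd))
  set S : Submodule ℝ Modes := LinearMap.ker
    (Complex.imCLM ∘L ContinuousLinearMap.fst ℝ ℂ (ℂ × ℂ × ℂ)).toLinearMap with hS
  have hmem : ∀ u : Modes, u ∈ S ↔ u.1.im = 0 := fun u => by simp [hS]
  have hStop : S ≠ ⊤ := fun h => by
    have h1 : ((Complex.I, 0) : Modes) ∈ S := h ▸ Submodule.mem_top
    simp [hmem] at h1
  refine measure_mono_null ?_ (addHaar_image_eq_zero_of_differentiableOn_of_addHaar_eq_zero volume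
    (hdiff.differentiableOn (s := S)) (Measure.addHaar_submodule volume S hStop))
  rintro ⟨v₁, v₃, m⟩ ⟨θ, b, hb⟩
  refine ⟨(((-θ : ℝ) : ℂ), b, m), (hmem _).2 (Complex.ofReal_im _), ?_⟩
  simp only [hΦ, Complex.ofReal_re]
  simp only at hb
  rw [hb, couplingFlow_neg_apply]

end

end EightMode

/-! ### The scalar profile -/

namespace EightMode

/-- The scalar part of the eight-mode model: `α = log (|ω₁|² + |ω₃|²)` and the common logarithmic
decay `L` of `ω₅` and `ω₇`. -/
theorem exists_scalar_profile {ν : ℝ} (hν : 0 < ν) (α₀ : ℝ) {s : ℝ} (hs : 0 ≤ s) :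
    ∃ α L : ℝ → ℝ, α 0 = α₀ ∧ L 0 = 0 ∧ Continuous L ∧
      (∀ t, 0 ≤ t → HasDerivAt L (2 * ν + Real.exp (α t) / (5 * ν)) t) ∧
      (∀ t, 0 ≤ t → HasDerivAt α (-2 * ν + 3 * s / (20 * ν) * Real.exp (-L t) ^ 2) t) ∧
      (∀ t, 0 ≤ t → 2 * ν * t ≤ L t) ∧
      ∃ K, ∀ t, 0 ≤ t → α t ≤ K - L t := by
  -- The pair has a first integral: L' = ψ'(α) and α' = g'(L) for the function `g` below, so ψ(α) -
  -- g(L) is constant. Taking g(0) = ψ(α₀) gives ψ(α) = g(L), which leaves one scalar equation for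
  -- `L`.
  set ψ : ℝ → ℝ := fun x => 2 * ν * x + Real.exp x / (5 * ν) with hψ
  have hψd : ∀ x, HasDerivAt ψ (2 * ν + Real.exp x / (5 * ν)) x := fun x => by
    have h := ((hasDerivAt_id x).const_mul (2 * ν)).add ((Real.hasDerivAt_exp x).div_const (5 * ν))
    exact h.congr_deriv (by simp)
  have hpos : ∀ x, 0 < 2 * ν + Real.exp x / (5 * ν) := fun x => by positivity
  have hmono : StrictMono ψ := strictMono_of_hasDerivAt_pos hψd hpos
  have hψc : Continuous ψ := continuous_iff_continuousAt.2 fun x => (hψd x).continuousAt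
  have hsurj : Function.Surjective ψ := by
    refine hψc.surjective ?_ ?_
    · refine tendsto_atTop_mono (fun x => ?_)
        (tendsto_id.const_mul_atTop (show 0 < 2 * ν by positivity))
      have : 0 ≤ Real.exp x / (5 * ν) := by positivity
      simp only [hψ, id]; linarith
    · have h1 : Tendsto (fun x : ℝ => 2 * ν * x) atBot atBot :=
        tendsto_id.const_mul_atBot (by positivity)
      exact h1.atBot_add (Real.tendsto_exp_atBot.div_const (5 * ν))
  set e := hmono.orderIsoOfSurjective ψ hsurj with he
  have heψ : ∀ x, e x = ψ x := fun x => rfl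
  have hed : ∀ y, HasDerivAt e.symm (2 * ν + Real.exp (e.symm y) / (5 * ν))⁻¹ y := fun y =>
    HasDerivAt.of_local_left_inverse (f := ψ) (g := e.symm) (a := y)
      e.symm.continuous.continuousAt (hψd (e.symm y)) (hpos _).ne'
      (Eventually.of_forall fun y => e.apply_symm_apply y)
  set g : ℝ → ℝ := fun l => ψ α₀ - 2 * ν * l + 3 * s / (40 * ν) * (1 - Real.exp (-l) ^ 2) with hg
  have hgd : ∀ l, HasDerivAt g (-2 * ν + 3 * s / (20 * ν) * Real.exp (-l) ^ 2) l := fun l => by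
    have h1 : HasDerivAt (fun l : ℝ => Real.exp (-l)) (-Real.exp (-l)) l := by
      simpa using (hasDerivAt_neg l).exp
    have h2 := (((hasDerivAt_id l).const_mul (2 * ν)).const_sub (ψ α₀)).add
      (((h1.pow 2).const_sub 1).const_mul (3 * s / (40 * ν)))
    refine h2.congr_deriv ?_
    field_simp
    simp
    ring
  have hgc : Continuous g := continuous_iff_continuousAt.2 fun x => (hgd x).continuousAt
  have hgle : ∀ l, g l ≤ ψ α₀ + 3 * s / (40 * ν) - 2 * ν * l := fun l => by
    have : 0 ≤ 3 * s / (40 * ν) * Real.exp (-l) ^ 2 := by positivity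
    simp only [hg]; linarith
  -- The maximum with 0 makes `h` bounded above, since `g` grows without bound as `l` tends to -∞;
  -- it is inactive because L ≥ 0 for t ≥ 0.
  set h : ℝ → ℝ := fun l => 2 * ν + Real.exp (e.symm (g (max l 0))) / (5 * ν) with hh
  obtain ⟨L, hL0, hLd, hLge⟩ := exists_hasDerivAt_of_pinched (h := h) (c := 2 * ν)
    (K := 2 * ν + Real.exp (e.symm (ψ α₀ + 3 * s / (40 * ν))) / (5 * ν))
    (by
      have : Continuous fun l : ℝ => e.symm (g (max l 0)) :=
        e.symm.continuous.comp (hgc.comp (continuous_id.max continuous_const))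
      simp only [hh]
      fun_prop)
    (by positivity)
    (fun x => by
      have : 0 ≤ Real.exp (e.symm (g (max x 0))) / (5 * ν) := by positivity
      simp only [hh]; linarith)
    (fun x => by
      have h1 : e.symm (g (max x 0)) ≤ e.symm (ψ α₀ + 3 * s / (40 * ν)) := by
        refine e.symm.monotone ((hgle _).trans ?_)
        have : 0 ≤ 2 * ν * max x 0 := by positivity
        linarith
      simp only [hh]
      gcongr)
  have hLnn : ∀ t, 0 ≤ t → max (L t) 0 = L t := fun t ht =>
    max_eq_left ((by positivity : 0 ≤ 2 * ν * t).trans (hLge t ht))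
  have hLd' : ∀ t, 0 ≤ t → HasDerivAt L (2 * ν + Real.exp (e.symm (g (L t))) / (5 * ν)) t :=
    fun t ht => by
      have h1 := hLd t
      simp only [hh, hLnn t ht] at h1
      exact h1
  refine ⟨fun t => e.symm (g (L t)), L, ?_, hL0,
    continuous_iff_continuousAt.2 fun x => (hLd x).continuousAt, hLd', fun t ht => ?_, hLge,
    (ψ α₀ + 3 * s / (40 * ν)) / (2 * ν), fun t ht => ?_⟩
  · have : g (L 0) = e α₀ := by simp [hg, hL0, heψ]
    simp only [this, e.symm_apply_apply]
  · have h1 := (hed (g (L t))).comp t ((hgd (L t)).comp t (hLd' t ht))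
    refine h1.congr_deriv ?_
    have := (hpos (e.symm (g (L t)))).ne'
    field_simp
  -- The bound follows from 2να ≤ ψ(α) = g(L) ≤ ψ(α₀) + 3s/(40ν) - 2νL.
  · have h1 : ψ (e.symm (g (L t))) = g (L t) := e.apply_symm_apply _
    have h2 := hgle (L t)
    rw [← h1] at h2
    have : 0 ≤ Real.exp (e.symm (g (L t))) / (5 * ν) := by positivity
    simp only [hψ] at h2
    rw [le_sub_iff_add_le, le_div_iff₀ (by positivity)]
    simp only [hψ]
    linarith

/-- A continuous function decaying exponentially has a primitive with an exponentially attained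
limit. -/
theorem exists_primitive_isBigO_exp {φ : ℝ → ℝ} (hφ : Continuous φ) {c : ℝ} (hc : 0 < c)
    (hb : ∀ t, 0 ≤ t → |φ t| ≤ Real.exp (-c * t)) :
    ∃ (θ : ℝ → ℝ) (l : ℝ), θ 0 = 0 ∧ (∀ t, HasDerivAt θ (φ t) t) ∧ Tendsto θ atTop (𝓝 l) ∧
      (fun t => θ t - l) =O[atTop] fun t => Real.exp (-c * t) := by
  have hd : ∀ t, HasDerivAt (fun t => ∫ s in (0 : ℝ)..t, φ s) (φ t) t := fun t =>
    (hφ.integral_hasStrictDerivAt 0 t).hasDerivAt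
  have hint : IntegrableOn φ (Ioi 0) := by
    refine (exp_neg_integrableOn_Ioi 0 hc).mono' hφ.aestronglyMeasurable.restrict ?_
    exact (ae_restrict_mem measurableSet_Ioi).mono fun t ht => hb t (mem_Ioi.1 ht).le
  have hlim := intervalIntegral_tendsto_integral_Ioi 0 hint tendsto_id
  have hlim' := hlim.sub_const (∫ x in Ioi 0, φ x)
  rw [sub_self] at hlim'
  refine ⟨_, _, intervalIntegral.integral_same, hd, hlim, ?_⟩
  refine IsBigO.of_bound (1 / c) ?_
  filter_upwards [eventually_ge_atTop 0] with t ht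
  rw [Real.norm_eq_abs, Real.norm_eq_abs, Real.abs_exp]
  exact abs_le_of_abs_deriv_le_exp hc (fun t _ => ((hd t).sub_const _).hasDerivWithinAt)
    (fun t ht => by rw [one_mul]; exact hb t ht) hlim' ht

end EightMode

/-! ### Selection of a dipole for generic data -/

namespace EightMode

/-- A solution of the eight-mode model selects a dipole as soon as neither component of `(ω₁, ω₃)`
is annihilated by the coupling flow. -/
theorem exists_isModeSolution_selecting {ν : ℝ} (hν : 0 < ν) (v m : ℂ × ℂ)
    (h1 : ∀ θ, (couplingFlow θ m v).1 ≠ 0) (h3 : ∀ θ, (couplingFlow θ m v).2 ≠ 0) :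
    ∃ u : ℝ → Modes, IsModeSolution ν u ∧ u 0 = (v.1, v.2, m) ∧
      ∃ r C κ : ℝ, 0 < r ∧ 0 < C ∧ 0 < κ ∧ ∀ᶠ t in atTop,
        ‖changeVars (u t) - fixedPoint r‖ ≤ C * Real.exp (-κ * t) := by
  set A₀ : ℝ := ‖v.1‖ ^ 2 + ‖v.2‖ ^ 2 with hA₀
  set s : ℝ := ‖m.1‖ ^ 2 + ‖m.2‖ ^ 2 with hs
  have hv1 : v.1 ≠ 0 := by simpa only [couplingFlow_zero] using h1 0
  have hA₀pos : 0 < A₀ := by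
    have := norm_pos_iff.2 hv1
    positivity
  have hν' : (ν : ℂ) ≠ 0 := by exact_mod_cast hν.ne'
  obtain ⟨α, L, hα0, hL0, hLc, hLd, hαd, hLge, K, hK⟩ :=
    exists_scalar_profile hν (Real.log A₀) (show 0 ≤ s by positivity)
  have hdecay : ∀ t, 0 ≤ t → Real.exp (-L t) ≤ Real.exp (-(2 * ν) * t) := fun t ht =>
    Real.exp_le_exp.2 (by linarith [hLge t ht])
  -- The clock of the coupling flow has speed e^{-L}/2, so it converges exponentially to a finite
  -- value `l`.
  obtain ⟨θ, l, hθ0, hθd, hθl, hθO⟩ := exists_primitive_isBigO_exp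
    (φ := fun t => Real.exp (-L t) / 2) (by fun_prop) (c := 2 * ν) (by positivity) (fun t ht => by
      rw [abs_of_pos (by positivity)]
      linarith [hdecay t ht, Real.exp_pos (-L t)])
  set F : ℝ → ℂ × ℂ := fun x => couplingFlow x m v with hF
  have hFd : ∀ x, HasDerivAt F (coupling m (F x)) x := hasDerivAt_couplingFlow m v
  set b : ℝ → ℝ := fun t => Real.exp ((α t - Real.log A₀) / 2) with hb
  have hb2 : ∀ t, b t ^ 2 * A₀ = Real.exp (α t) := fun t => by
    rw [hb, ← Real.exp_nat_mul]
    nth_rewrite 2 [← Real.exp_log hA₀pos]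
    rw [← Real.exp_add]
    congr 1
    push_cast
    ring
  have hFn : ∀ x, ‖(F x).1‖ ^ 2 + ‖(F x).2‖ ^ 2 = A₀ := norm_sq_couplingFlow m v
  have hbpos : ∀ t, 0 < b t := fun t => Real.exp_pos _
  have hAt : ∀ t, ‖(b t : ℂ) * (F (θ t)).1‖ ^ 2 + ‖(b t : ℂ) * (F (θ t)).2‖ ^ 2 =
      Real.exp (α t) := fun t => by
    rw [← hb2, ← hFn (θ t), norm_mul, norm_mul, Complex.norm_real, Real.norm_eq_abs,
      mul_pow, mul_pow, sq_abs]
    ring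
  have hst : ∀ t, ‖((Real.exp (-L t) : ℝ) : ℂ) * m.1‖ ^ 2 +
      ‖((Real.exp (-L t) : ℝ) : ℂ) * m.2‖ ^ 2 = Real.exp (-L t) ^ 2 * s := fun t => by
    rw [norm_mul, norm_mul, Complex.norm_real, Real.norm_eq_abs, Real.abs_exp]
    ring
  -- Since (ω₅, ω₇) = e^{-L} m, the coupling only advances the linear flow of `m` by the clock θ,
  -- while the terms common to ω₁ and ω₃ go into the real amplitude `b`, the square root of e^α /
  -- A₀.
  refine ⟨fun t => (b t * (F (θ t)).1, b t * (F (θ t)).2, (Real.exp (-L t) : ℝ) * m.1,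
    (Real.exp (-L t) : ℝ) * m.2), fun t ht => ?_, ?_, ?_⟩
  · have hbd : HasDerivAt b (b t * (-ν + 3 * s / (40 * ν) * Real.exp (-L t) ^ 2)) t := by
      refine (((hαd t ht).sub_const (Real.log A₀)).div_const 2).exp.congr_deriv ?_
      rw [hb]
      field_simp
      ring
    have hld : HasDerivAt (fun t => Real.exp (-L t))
        (-Real.exp (-L t) * (2 * ν + Real.exp (α t) / (5 * ν))) t := by
      refine (hLd t ht).neg.exp.congr_deriv ?_
      rw [Pi.neg_apply]
      ring
    have hFt := ((hFd (θ t)).scomp t (hθd t)).hasDerivWithinAt (s := Ici 0)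
    have hF1 : HasDerivWithinAt (fun τ => (F (θ τ)).1) _ (Ici 0) t := hasDerivWithinAt_fst hFt
    have hF2 : HasDerivWithinAt (fun τ => (F (θ τ)).2) _ (Ici 0) t := hasDerivWithinAt_snd hFt
    have hbw := hbd.hasDerivWithinAt (s := Ici 0) |>.ofReal_comp
    have hlw := hld.hasDerivWithinAt (s := Ici 0) |>.ofReal_comp
    have hall := (hbw.mul hF1).prodMk ((hbw.mul hF2).prodMk
      ((hlw.mul_const m.1).prodMk (hlw.mul_const m.2)))
    refine hall.congr_deriv ?_
    simp only [modeField, hAt, hst, coupling_apply]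
    generalize Real.exp (-L t) = lam
    generalize F (θ t) = G
    generalize b t = c
    generalize Real.exp (α t) = A
    clear_value s
    refine Prod.ext ?_ (Prod.ext ?_ (Prod.ext ?_ ?_))
    all_goals
      simp only [Prod.smul_mk, Complex.real_smul, map_mul, Complex.conj_ofReal]
      push_cast
      field_simp
      ring
  · simp [hb, hα0, hL0, hθ0, hF, couplingFlow_zero]
  · have hG1 : (F l).1 ≠ 0 := h1 l
    have hG3 : (F l).2 ≠ 0 := h3 l
    have hE : ∀ t, 0 ≤ t → Real.exp (α t) ≤ Real.exp K * Real.exp (-(2 * ν) * t) := fun t ht => by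
      rw [← Real.exp_add]
      exact Real.exp_le_exp.2 (by linarith [hK t ht, hLge t ht])
    set E : ℝ → ℝ := fun t => Real.exp (-(2 * ν) * t) with hEdef
    have hlO : (fun t => Real.exp (-L t)) =O[atTop] E := by
      refine IsBigO.of_bound 1 ?_
      filter_upwards [eventually_ge_atTop 0] with t ht
      rw [Real.norm_eq_abs, Real.norm_eq_abs, Real.abs_exp, Real.abs_exp, one_mul]
      exact hdecay t ht
    have hlC : (fun t => ((Real.exp (-L t) : ℝ) : ℂ)) =O[atTop] E :=
      (IsBigO.of_bound 1 (Eventually.of_forall fun t => by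
        rw [Complex.norm_real, one_mul])).trans hlO
    have hlOne : (fun t => Real.exp (-L t)) =O[atTop] fun _ => (1 : ℝ) := by
      refine IsBigO.of_bound 1 ?_
      filter_upwards [eventually_ge_atTop 0] with t ht
      rw [Real.norm_eq_abs, Real.abs_exp, norm_one, one_mul, Real.exp_le_one_iff]
      have := hLge t ht
      have : 0 ≤ 2 * ν * t := by positivity
      linarith
    have hAO : (fun t => Real.exp (α t)) =O[atTop] E := by
      refine IsBigO.of_bound (Real.exp K) ?_
      filter_upwards [eventually_ge_atTop 0] with t ht
      rw [Real.norm_eq_abs, Real.norm_eq_abs, Real.abs_exp, Real.abs_exp]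
      exact hE t ht
    have hF1d : DifferentiableAt ℝ (fun x => (F x).1) l := (hFd l).differentiableAt.fst
    have hF3d : DifferentiableAt ℝ (fun x => (F x).2) l := (hFd l).differentiableAt.snd
    have hN3 : ‖(F l).2‖ ^ 2 ≠ 0 := by positivity
    have hcont : ∀ {G : Type} [NormedAddCommGroup G] [NormedSpace ℝ G] {k : ℝ → G},
        DifferentiableAt ℝ k l → (fun t => k (θ t)) =O[atTop] fun _ => (1 : ℝ) :=
      fun hk => ((hk.continuousAt.tendsto.comp hθl).isBigO_one ℝ)
    have hn1 : DifferentiableAt ℝ (fun x => ‖(F x).1‖ ^ 2) l := hF1d.norm_sq ℝ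
    have hn3 : DifferentiableAt ℝ (fun x => ‖(F x).2‖ ^ 2) l := hF3d.norm_sq ℝ
    have hn3c : DifferentiableAt ℝ (fun x => ((‖(F x).2‖ ^ 2 : ℝ) : ℂ)) l :=
      Complex.ofRealCLM.differentiableAt.comp l hn3
    have hc1 : DifferentiableAt ℝ (fun x => conj (F x).1) l :=
      (Complex.conjCLE : ℂ →L[ℝ] ℂ).differentiableAt.comp l hF1d
    have hc3 : DifferentiableAt ℝ (fun x => conj (F x).2) l :=
      (Complex.conjCLE : ℂ →L[ℝ] ℂ).differentiableAt.comp l hF3d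
    -- The amplitude `b` cancels in `R`, `P` and `Q`. Thus `R` is a differentiable function of θ
    -- near `l` and inherits the rate of θ, while `P` and `Q` are bounded functions of θ times
    -- e^{-L}.
    have hR : (fun t => ‖(F (θ t)).1‖ ^ 2 / ‖(F (θ t)).2‖ ^ 2 - ‖(F l).1‖ ^ 2 / ‖(F l).2‖ ^ 2)
        =O[atTop] E :=
      ((hn1.fun_div hn3 hN3).isBigO_sub.comp_tendsto hθl).trans hθO
    have hP := (hcont ((hF1d.fun_mul hc3).mul_const (conj m.2) |>.fun_div hn3c
      (by exact_mod_cast hN3))).mul hlC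
    have hQ := (hcont ((hc1.fun_mul hc3).mul_const m.1 |>.fun_div hn3c
      (by exact_mod_cast hN3))).mul hlC
    have hsq : ∀ c : ℂ, (fun t => ‖((Real.exp (-L t) : ℝ) : ℂ) * c‖ ^ 2) =O[atTop] E := fun c => by
      have h := (hlO.mul hlOne).const_mul_left (‖c‖ ^ 2)
      refine (h.congr_left fun t => ?_).congr_right fun t => mul_one _
      rw [norm_mul, Complex.norm_real, Real.norm_eq_abs, Real.abs_exp]
      ring
    have hall : (fun t => changeVars (b t * (F (θ t)).1, b t * (F (θ t)).2,
        (Real.exp (-L t) : ℝ) * m.1, (Real.exp (-L t) : ℝ) * m.2) -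
        fixedPoint (‖(F l).1‖ ^ 2 / ‖(F l).2‖ ^ 2)) =O[atTop] E := by
      have h := hR.prod_left (hAO.prod_left ((hsq m.1).prod_left ((hsq m.2).prod_left
        ((hP.congr_right fun t => one_mul _).prod_left (hQ.congr_right fun t => one_mul _)))))
      refine h.congr_left fun t => ?_
      have hb0 : (b t : ℂ) ≠ 0 := by exact_mod_cast (hbpos t).ne'
      have hF0 : ((‖(F (θ t)).2‖ : ℝ) : ℂ) ≠ 0 := by
        exact_mod_cast (norm_pos_iff.2 (h3 (θ t))).ne'
      have hF0' : ‖(F (θ t)).2‖ ≠ 0 := (norm_pos_iff.2 (h3 (θ t))).ne'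
      have hbn : ‖(b t : ℂ)‖ = b t := by
        rw [Complex.norm_real, Real.norm_eq_abs, abs_of_pos (hbpos t)]
      have hbt := (hbpos t).ne'
      simp only [changeVars, fixedPoint, hAt]
      refine Prod.ext ?_ (Prod.ext ?_ (Prod.ext ?_ (Prod.ext ?_ (Prod.ext ?_ ?_))))
      · simp only [Prod.fst_sub, norm_mul, hbn]
        congr 1
        field_simp
      · simp
      · simp
      · simp
      · simp only [Prod.snd_sub, sub_zero, norm_mul, hbn, map_mul, Complex.conj_ofReal]
        push_cast
        field_simp
      · simp only [Prod.snd_sub, sub_zero, norm_mul, hbn, map_mul, Complex.conj_ofReal]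
        push_cast
        field_simp
    obtain ⟨C, hC, hbound⟩ := hall.exists_pos
    refine ⟨‖(F l).1‖ ^ 2 / ‖(F l).2‖ ^ 2, C, 2 * ν, by positivity, hC, by positivity, ?_⟩
    filter_upwards [hbound.bound] with t ht
    simpa only [hEdef, Real.norm_eq_abs, Real.abs_exp] using ht

/-- Almost every initial condition of the eight-mode model selects a dipole. -/
theorem ae_exists_isModeSolution_selecting {ν : ℝ} (hν : 0 < ν) :
    ∀ᵐ u₀ : Modes, ∃ u : ℝ → Modes, IsModeSolution ν u ∧ u 0 = u₀ ∧
      ∃ r C κ : ℝ, 0 < r ∧ 0 < C ∧ 0 < κ ∧ ∀ᶠ t in atTop,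
        ‖changeVars (u t) - fixedPoint r‖ ≤ C * Real.exp (-κ * t) := by
  have h1 : ∀ᵐ u₀ : Modes, ¬ ∃ θ : ℝ, couplingFlow θ u₀.2.2 (u₀.1, u₀.2.1) ∈
      range (ContinuousLinearMap.inr ℝ ℂ ℂ) :=
    measure_eq_zero_iff_ae_notMem.1 (volume_exists_couplingFlow_mem_range _)
  have h3 : ∀ᵐ u₀ : Modes, ¬ ∃ θ : ℝ, couplingFlow θ u₀.2.2 (u₀.1, u₀.2.1) ∈
      range (ContinuousLinearMap.inl ℝ ℂ ℂ) :=
    measure_eq_zero_iff_ae_notMem.1 (volume_exists_couplingFlow_mem_range _)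
  filter_upwards [h1, h3] with u₀ h1 h3
  exact exists_isModeSolution_selecting hν (u₀.1, u₀.2.1) u₀.2.2
    (fun θ h => h1 ⟨θ, _, Prod.ext h.symm rfl⟩) (fun θ h => h3 ⟨θ, _, Prod.ext rfl h.symm⟩)

end EightMode

theorem theorem3p2 (ν : ℝ) (hν : 0 < ν) :
    -- the change of variables carries the eight-mode model to the system in `(R, A, w, z, P, Q)`
    (∀ u : ℝ → EightMode.Modes, EightMode.IsModeSolution ν u →
      (∀ t, 0 ≤ t → (u t).1 ≠ 0 ∧ (u t).2.1 ≠ 0) →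
      EightMode.IsReducedSolution ν (fun t => EightMode.changeVars (u t))) ∧
    -- the family of local stable manifolds `M_r = {R = f(A, w, z, P, Q; r)}`
    (∃ f : ℝ → EightMode.Transverse → ℝ, ∀ r : ℝ, 0 < r →
      -- smoothness and the expansion up to and including quadratic terms
      (fun y => f r y - EightMode.quadraticPart ν r y) =O[𝓝 0] (fun y => ‖y‖ ^ 3) ∧
      ∃ (V : Set EightMode.Transverse) (U : Set EightMode.State) (C κ : ℝ),
        IsOpen V ∧ 0 ∈ V ∧ ContDiffOn ℝ ∞ (f r) V ∧ f r 0 = r ∧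
        IsOpen U ∧ EightMode.fixedPoint r ∈ U ∧ 0 < C ∧ 0 < κ ∧
        -- trajectories from `M_r` are global, stay on it, and converge exponentially
        (∀ x ∈ EightMode.graphOver (f r) V,
          (∃ X : ℝ → EightMode.State, EightMode.IsReducedSolution ν X ∧ X 0 = x) ∧
          ∀ X : ℝ → EightMode.State, EightMode.IsReducedSolution ν X → X 0 = x →
            ∀ t, 0 ≤ t → X t ∈ EightMode.graphOver (f r) V ∧
              ‖X t - EightMode.fixedPoint r‖ ≤
                C * ‖x - EightMode.fixedPoint r‖ * Real.exp (-κ * t)) ∧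
        -- near the fixed point, `M_r` is exactly the set of points attracted to it
        (∀ x ∈ U, x ∈ EightMode.graphOver (f r) V ↔
          ∃ X : ℝ → EightMode.State, EightMode.IsReducedSolution ν X ∧ X 0 = x ∧
            Tendsto X atTop (𝓝 (EightMode.fixedPoint r))) ∧
        -- every trajectory starting near the fixed point selects some dipole `r' > 0`
        (∀ x ∈ U,
          (∃ X : ℝ → EightMode.State, EightMode.IsReducedSolution ν X ∧ X 0 = x) ∧
          ∀ X : ℝ → EightMode.State, EightMode.IsReducedSolution ν X → X 0 = x →
            ∃ r' : ℝ, 0 < r' ∧ ∀ t, 0 ≤ t →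
              ‖X t - EightMode.fixedPoint r'‖ ≤ C * Real.exp (-κ * t))) ∧
    -- almost every initial condition of the eight-mode model selects a dipole
    (∀ᵐ u₀ : EightMode.Modes, ∃ u : ℝ → EightMode.Modes,
      EightMode.IsModeSolution ν u ∧ u 0 = u₀ ∧
      ∃ r C κ : ℝ, 0 < r ∧ 0 < C ∧ 0 < κ ∧ ∀ᶠ t in atTop,
        ‖EightMode.changeVars (u t) - EightMode.fixedPoint r‖ ≤ C * Real.exp (-κ * t)) := by
  choose! f hf using fun (r : ℝ) (hr : 0 < r) => EightMode.exists_local_stable_manifold hν hr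
  exact ⟨fun u hu h0 => hu.isReducedSolution hν.ne' h0, ⟨f, hf⟩,
    EightMode.ae_exists_isModeSolution_selecting hν⟩
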